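/- Write $e(t)=\exp(2\pi i t)$. For $n\ge 1$ let $$C_n=\sup_{t_n}\frac{\|t_n\|_C}{\|t_n\|_L},\qquad \|t\|_C=\max_{|x|\le 1/2}|t(x)|,\quad \|t\|_L=\int_{-1/2}^{1/2}|t(x)|\,dx,$$ the supremum being over the nonzero real trigonometric polynomials $t_n(x)=\sum_{|\nu|<n}a_\nu e(\nu x)$ of degree less than $n$. Let $q_k=k/2-1/4$. For $1/2<z_1<1<z_2<3/2$ and $k=1,2,3$ put $$\omega_k(z)=\frac{(z_1^2-z^2)(z_2^2-z^2)}{\prod_{j\in\{1,2,3\},\,j\ne k}(q_j^2-z^2)},\qquad \sigma_k(x)=\begin{cases}\dfrac{\pi}{q_k}\sin\bigl(2\pi q_k(1-|x|)\bigr),&|x|<1,\\ 0,&|x|\ge 1,\end{cases}$$ $$\varphi(x)=\sum_{k=1}^3\omega_k(q_k)\sigma_k(x),\qquad \widehat\varphi(z)=\int_{\mathbb R}\varphi(x)e(-zx)\,dx,\qquad F_n(x)=\sum_{|\nu|<n}\varphi\!\left(\frac{\nu}{n}\right)e(\nu x),$$ $$\rho(z_1,z_2)=\widehat\varphi(0)\left[4\left(\int_0^{q_1}+\int_{q_2}^{q_3}-\int_{z_1}^{z_2}\right)\widehat\varphi(z)\,dz\right]^{-1}.$$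 COROLLARY. On the region $1/2<z_1<1<z_2<3/2$ the function $\rho$ attains its maximum at a point $(z_1^*,z_2^*)$ with $z_1^*=0.72096\ldots$, $z_2^*=1.23305\ldots$ and $\rho(z_1^*,z_2^*)=1.08176\ldots$ (decimals truncated), and $$C_n\ \ge\ \rho(z_1^*,z_2^*)\,n+O(1/n)=(1.08176\ldots)\,n+O(1/n)\qquad(n\ge1).$$ The bound is given by the polynomials $F_n$ with $z_1=z_1^*$, $z_2=z_2^*$: for these, $\|F_n\|_C/\|F_n\|_L\ge\rho(z_1^*,z_2^*)\,n+O(1/n)$. This improves Taykov's lower bound, whose leading constant is $2\big/\int_0^\pi\frac{\sin t}{t}\,dt=1.07995\ldots$. Taykov's constant is recovered at $z_1=q_2$, $z_2=q_3$: $\rho(q_2,q_3)=2\big/\int_0^\pi\frac{\sin t}{t}\,dt$, and for the corresponding $F_n$ one has $\|F_n\|_C/\|F_n\|_L\ge\rho(q_2,q_3)\,n+O(1/n)$. (Here $A_n\ge B_n+O(1/n)$ means that there is a real constant $K$, independent of $n$, with $A_n\ge B_n-K/n$ for all $n\ge1$.) -/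

import Mathlib

open Real Set MeasureTheory
open scoped FourierTransform

noncomputable section

namespace TrigNorms

/-- `e(t) = exp(2πit)`. -/
def e (t : ℝ) : ℂ := Complex.exp (2 * π * Complex.I * t)

/-- `t` is a real trigonometric polynomial of period `1` and degree `< n`:
`t(x) = ∑_{|ν| < n} a(ν) e(νx)`, with `t` real-valued. -/
def IsRealTrigPoly (n : ℕ) (t : ℝ → ℝ) : Prop :=
  ∃ a : ℤ → ℂ, ∀ x : ℝ, (t x : ℂ) = ∑ ν ∈ Finset.Ioo (-(n : ℤ)) (n : ℤ), a ν * e (ν * x)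

/-- The uniform norm over one period. -/
def normC (t : ℝ → ℝ) : ℝ := sSup ((fun x => |t x|) '' Icc (-(1 / 2) : ℝ) (1 / 2))

/-- The `L` norm over one period. -/
def normL (t : ℝ → ℝ) : ℝ := ∫ x in (-(1 / 2) : ℝ)..(1 / 2), |t x|

/-- The best constant `C_n` in the inequality between the `C` and `L` norms
for real trigonometric polynomials of degree `< n`. -/
def bestConst (n : ℕ) : ℝ :=
  sSup {r : ℝ | ∃ t : ℝ → ℝ, IsRealTrigPoly n t ∧ t ≠ 0 ∧ r = normC t / normL t}

/-- The zeros `q_k = k/2 - 1/4` of `cos(2πt)`. -/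
def q (k : ℤ) : ℝ := k / 2 - 1 / 4

/-- `ω_k(z) = (z₁² - z²)(z₂² - z²) / ∏_{j ∈ {1,2,3}, j ≠ k} (q_j² - z²)`. -/
def omega (z₁ z₂ : ℝ) (k : ℤ) (z : ℝ) : ℝ :=
  (z₁ ^ 2 - z ^ 2) * (z₂ ^ 2 - z ^ 2) /
    ∏ j ∈ (Finset.Icc (1 : ℤ) 3).erase k, (q j ^ 2 - z ^ 2)

/-- `σ_k(x) = (π/q_k) sin(2π q_k (1 - |x|))` for `|x| < 1`, and `0` otherwise. -/
def sigma (k : ℤ) (x : ℝ) : ℝ :=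
  if |x| < 1 then π / q k * sin (2 * π * (q k * (1 - |x|))) else 0

/-- `φ(x) = ∑_{k=1}^{3} ω_k(q_k) σ_k(x)`. -/
def phi (z₁ z₂ : ℝ) (x : ℝ) : ℝ :=
  ∑ k ∈ Finset.Icc (1 : ℤ) 3, omega z₁ z₂ k (q k) * sigma k x

/-- The Fourier transform `∫ φ(x) e(-zx) dx`; it is real since `φ` is real and even. -/
def phiHat (z₁ z₂ : ℝ) (z : ℝ) : ℝ :=
  (𝓕 (fun x : ℝ => (phi z₁ z₂ x : ℂ)) z).re

/-- `F_n(x) = ∑_{|ν| < n} φ(ν/n) e(νx)`; the sum is real since `φ` is real and even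
(see `coe_F`). -/
def F (z₁ z₂ : ℝ) (n : ℕ) (x : ℝ) : ℝ :=
  (∑ ν ∈ Finset.Ioo (-(n : ℤ)) (n : ℤ), (phi z₁ z₂ (ν / n) : ℂ) * e (ν * x)).re

/-- `ρ(z₁, z₂) = φ̂(0) / (4 (∫_0^{q_1} + ∫_{q_2}^{q_3} - ∫_{z₁}^{z₂}) φ̂(z) dz)`. -/
def rho (z₁ z₂ : ℝ) : ℝ :=
  phiHat z₁ z₂ 0 /
    (4 * ((∫ z in (0 : ℝ)..q 1, phiHat z₁ z₂ z) + (∫ z in q 2..q 3, phiHat z₁ z₂ z) -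
      ∫ z in z₁..z₂, phiHat z₁ z₂ z))

theorem phi_neg (z₁ z₂ x : ℝ) : phi z₁ z₂ (-x) = phi z₁ z₂ x := by
  simp [phi, sigma]

theorem conj_e (t : ℝ) : (starRingEnd ℂ) (e t) = e (-t) := by
  simp [e, ← Complex.exp_conj, Complex.conj_ofNat]

theorem coe_F (z₁ z₂ : ℝ) (n : ℕ) (x : ℝ) :
    (F z₁ z₂ n x : ℂ) =
      ∑ ν ∈ Finset.Ioo (-(n : ℤ)) (n : ℤ), (phi z₁ z₂ (ν / n) : ℂ) * e (ν * x) := by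
  unfold F
  rw [← Complex.conj_eq_iff_re, map_sum]
  refine Finset.sum_bij' (fun ν _ => -ν) (fun ν _ => -ν) ?_ ?_ ?_ ?_ ?_
  · intro a ha; simp only [Finset.mem_Ioo] at ha ⊢; omega
  · intro a ha; simp only [Finset.mem_Ioo] at ha ⊢; omega
  · simp
  · simp
  · intro a _
    rw [map_mul, conj_e, Complex.conj_ofReal]
    push_cast
    rw [neg_div, phi_neg, neg_mul]

end TrigNorms

end

namespace TrigNorms

/-! ### The sine integral -/

/-! The transform of σ_k is the entire function extending cos(2πz)/(q_k² - z²), so by partial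
fractions φ̂(z) = (z₁² - z²)(z₂² - z²) cos(2πz) / ∏ (q_j² - z²), with removable singularities and
decay z⁻². As φ vanishes off (-1, 1), Poisson summation gives F_n(x) = ∑ n φ̂(n(x + m))
(`F_eq_tsum`). At x = 0 the terms with m ≠ 0 contribute O(1/n), so F_n(0) ≥ n φ̂(0) - K/n, and
unfolding the period integral gives ‖F_n‖_L ≤ ∫ |φ̂|. The ratio is therefore at least ρ n + O(1/n)
once ∫ |φ̂| is identified with the denominator of ρ.

For that, let S be the sign of cos(2πz). Poisson summation with n = 1 shows ∫ φ̂ S = 0, because F_1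
is constant and S has mean zero. Hence ∫ |φ̂| = ∫ (|φ̂| + φ̂ S). Far out, φ̂ has the sign of -S and
the integrand vanishes; near the origin it is ±2φ̂ or 0 on explicit intervals, which gives
`integral_abs_phiHat`.

The maximum of ρ comes from a duality argument, not from derivatives. Put m_i(z) = z^(2i) cos(2πz) /
∏ (q_j² - z²) and let M_i(z₁, z₂) be the functional ∫_0^{q₁} + ∫_{q₂}^{q₃} - ∫_{z₁}^{z₂} applied to
m_i (`momFun`). For parameters w, φ̂ = w₁²w₂² m₀ - (w₁² + w₂²) m₁ + m₂ is negative essentially only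
between w₁ and w₂ in the relevant range, so replacing ∫_{w₁}^{w₂} by ∫_{z₁}^{z₂} can only lower the
denominator. If M₁ = M₂ = 0 at z, the lowered value is 4 w₁²w₂² M₀(z); since φ̂(0) is also
proportional to w₁²w₂², this bounds ρ(w) by a constant, attained at w = z.

It remains to locate a common zero of M₁ and M₂. Primitives of the m_i are combinations of sine
integrals, enclosed by Taylor polynomials; signs at three corners of a tiny rectangle then force a
zero inside it (`exists_momFun_eq_zero`). -/

/-- The sine integral `∫₀ˣ sin t / t dt`. -/
noncomputable def Si (x : ℝ) : ℝ := ∫ t in (0 : ℝ)..x, sinc t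

theorem hasDerivAt_Si (x : ℝ) : HasDerivAt Si (sinc x) x :=
  intervalIntegral.integral_hasDerivAt_right (continuous_sinc.intervalIntegrable _ _)
    (continuous_sinc.stronglyMeasurableAtFilter _ _) continuous_sinc.continuousAt

theorem Si_zero : Si 0 = 0 := by simp [Si]

theorem continuous_Si : Continuous Si :=
  continuous_iff_continuousAt.2 fun x => (hasDerivAt_Si x).continuousAt

theorem Si_neg (x : ℝ) : Si (-x) = -Si x := by
  have h := intervalIntegral.integral_comp_neg (a := 0) (b := x) sinc
  simp only [sinc_neg, neg_zero] at h
  rw [Si, Si, h, ← intervalIntegral.integral_symm]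

theorem abs_Si_sub_le (x y : ℝ) : |Si x - Si y| ≤ |x - y| := by
  have h := Convex.norm_image_sub_le_of_norm_hasDerivWithin_le (f := Si) (s := univ) (C := 1)
    (fun z _ => (hasDerivAt_Si z).hasDerivWithinAt)
    (fun z _ => abs_sinc_le_one z) convex_univ (mem_univ y) (mem_univ x)
  simpa using h

theorem integral_sin_div_eq_Si (b : ℝ) : ∫ t in (0 : ℝ)..b, sin t / t = Si b := by
  refine intervalIntegral.integral_congr_ae ?_
  filter_upwards [(measure_eq_zero_iff_ae_notMem.1 (by simp : volume ({0} : Set ℝ) = 0))]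
    with t ht _
  rw [sinc_of_ne_zero (by simpa using ht)]

/-! ### Alternating Taylor bounds for `cos`, `sin` and `Si` -/

theorem nonneg_of_hasDerivAt_nonneg {f f' : ℝ → ℝ} (hf : ∀ x, HasDerivAt f (f' x) x)
    (hf' : ∀ x, 0 < x → 0 ≤ f' x) (h0 : f 0 = 0) {x : ℝ} (hx : 0 ≤ x) : 0 ≤ f x := by
  have hm : MonotoneOn f (Ici 0) := by
    refine monotoneOn_of_deriv_nonneg (convex_Ici 0)
      (fun y _ => (hf y).continuousAt.continuousWithinAt)
      (fun y _ => (hf y).differentiableAt.differentiableWithinAt) fun y hy => ?_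
    rw [interior_Ici] at hy
    rw [(hf y).deriv]
    exact hf' y hy
  simpa [h0] using hm self_mem_Ici hx hx

/-- Taylor polynomials of `cos`. -/
noncomputable def cosPoly (N : ℕ) (x : ℝ) : ℝ :=
  ∑ k ∈ Finset.range N, (-1) ^ k * x ^ (2 * k) / (2 * k).factorial

/-- Taylor polynomials of `sin`. -/
noncomputable def sinPoly (N : ℕ) (x : ℝ) : ℝ :=
  ∑ k ∈ Finset.range N, (-1) ^ k * x ^ (2 * k + 1) / (2 * k + 1).factorial

/-- Taylor polynomials of `Si`. -/
noncomputable def SiPoly (N : ℕ) (x : ℝ) : ℝ :=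
  ∑ k ∈ Finset.range N, (-1) ^ k * x ^ (2 * k + 1) / ((2 * k + 1) * (2 * k + 1).factorial)

theorem hasDerivAt_sinPoly (N : ℕ) (x : ℝ) : HasDerivAt (sinPoly N) (cosPoly N x) x := by
  unfold sinPoly cosPoly
  refine HasDerivAt.fun_sum fun k _ => ?_
  have h := ((hasDerivAt_pow (2 * k + 1) x).const_mul ((-1 : ℝ) ^ k)).div_const
    ((2 * k + 1).factorial : ℝ)
  refine h.congr_deriv ?_
  rw [Nat.factorial_succ]
  have := Nat.factorial_ne_zero (2 * k)
  push_cast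
  field_simp

theorem hasDerivAt_cosPoly_succ (N : ℕ) (x : ℝ) :
    HasDerivAt (cosPoly (N + 1)) (-sinPoly N x) x := by
  have hfun : cosPoly (N + 1) = fun x : ℝ => (∑ k ∈ Finset.range N,
      (-1 : ℝ) ^ (k + 1) * x ^ (2 * (k + 1)) / (2 * (k + 1)).factorial) + 1 := by
    funext x
    simp [cosPoly, Finset.sum_range_succ']
  rw [hfun, sinPoly, ← Finset.sum_neg_distrib]
  refine (HasDerivAt.fun_sum fun k _ => ?_).add_const 1
  have h := ((hasDerivAt_pow (2 * (k + 1)) x).const_mul ((-1 : ℝ) ^ (k + 1))).div_const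
    ((2 * (k + 1)).factorial : ℝ)
  refine h.congr_deriv ?_
  rw [show 2 * (k + 1) = (2 * k + 1) + 1 by ring, Nat.factorial_succ]
  have := Nat.factorial_ne_zero (2 * k + 1)
  push_cast
  field_simp
  ring

theorem hasDerivAt_SiPoly {N : ℕ} {x : ℝ} (hx : x ≠ 0) :
    HasDerivAt (SiPoly N) (sinPoly N x / x) x := by
  unfold SiPoly sinPoly
  rw [Finset.sum_div]
  refine HasDerivAt.fun_sum fun k _ => ?_
  have h := ((hasDerivAt_pow (2 * k + 1) x).const_mul ((-1 : ℝ) ^ k)).div_const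
    ((2 * k + 1) * (2 * k + 1).factorial : ℝ)
  refine h.congr_deriv ?_
  have := Nat.factorial_ne_zero (2 * k + 1)
  push_cast
  field_simp
  ring

theorem continuous_SiPoly (N : ℕ) : Continuous (SiPoly N) := by
  unfold SiPoly
  fun_prop

theorem SiPoly_zero (N : ℕ) : SiPoly N 0 = 0 := by simp [SiPoly]

/-- Each remainder vanishes at 0 and its derivative is, up to sign, the preceding one, so the signs
alternate by induction starting from cos ≤ 1. -/
theorem taylor_remainder_nonneg (N : ℕ) :
    (∀ x : ℝ, 0 ≤ x → 0 ≤ (-1) ^ (N + 1) * (cos x - cosPoly (N + 1) x)) ∧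
    (∀ x : ℝ, 0 ≤ x → 0 ≤ (-1) ^ (N + 1) * (sin x - sinPoly (N + 1) x)) := by
  have step : ∀ N : ℕ, (∀ x : ℝ, 0 ≤ x → 0 ≤ (-1) ^ (N + 1) * (cos x - cosPoly (N + 1) x)) →
      ∀ x : ℝ, 0 ≤ x → 0 ≤ (-1) ^ (N + 1) * (sin x - sinPoly (N + 1) x) := by
    intro N hN x hx
    exact nonneg_of_hasDerivAt_nonneg (f := fun x => (-1) ^ (N + 1) * (sin x - sinPoly (N + 1) x))
      (fun y => (((hasDerivAt_sin y).sub (hasDerivAt_sinPoly (N + 1) y)).const_mul _))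
      (fun y hy => hN y hy.le) (by simp [sinPoly]) hx
  induction N with
  | zero =>
    have h : ∀ x : ℝ, 0 ≤ x → 0 ≤ (-1) ^ (0 + 1) * (cos x - cosPoly (0 + 1) x) := fun x _ => by
      simpa [cosPoly] using cos_le_one x
    exact ⟨h, step 0 h⟩
  | succ N ih =>
    have h : ∀ x : ℝ, 0 ≤ x → 0 ≤ (-1) ^ (N + 1 + 1) * (cos x - cosPoly (N + 1 + 1) x) := by
      intro x hx
      refine nonneg_of_hasDerivAt_nonneg
        (f := fun x => (-1) ^ (N + 1 + 1) * (cos x - cosPoly (N + 1 + 1) x))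
        (f' := fun x => (-1) ^ (N + 1 + 1) * (-sin x - -sinPoly (N + 1) x))
        (fun y => (((hasDerivAt_cos y).sub (hasDerivAt_cosPoly_succ (N + 1) y)).const_mul _))
        (fun y hy => ?_) ?_ hx
      · have := ih.2 y hy.le
        rw [pow_succ]
        linarith
      · simp [cosPoly, Finset.sum_range_succ']
    exact ⟨h, step (N + 1) h⟩

theorem Si_remainder_nonneg (N : ℕ) {x : ℝ} (hx : 0 ≤ x) :
    0 ≤ (-1) ^ (N + 1) * (Si x - SiPoly (N + 1) x) := by
  have hd : ∀ y : ℝ, 0 < y → HasDerivAt (fun x => (-1) ^ (N + 1) * (Si x - SiPoly (N + 1) x))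
      ((-1) ^ (N + 1) * (sinc y - sinPoly (N + 1) y / y)) y := fun y hy =>
    ((hasDerivAt_Si y).sub (hasDerivAt_SiPoly hy.ne')).const_mul _
  have hm : MonotoneOn (fun x => (-1) ^ (N + 1) * (Si x - SiPoly (N + 1) x)) (Ici 0) := by
    refine monotoneOn_of_deriv_nonneg (convex_Ici 0)
      (continuous_const.mul (continuous_Si.sub (continuous_SiPoly _))).continuousOn
      (fun y hy => ?_) fun y hy => ?_
    · rw [interior_Ici] at hy
      exact (hd y hy).differentiableAt.differentiableWithinAt
    · rw [interior_Ici, mem_Ioi] at hy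
      rw [(hd y hy).deriv, sinc_of_ne_zero hy.ne', ← sub_div, mul_div_assoc']
      exact div_nonneg ((taylor_remainder_nonneg N).2 y hy.le) hy.le
  simpa [Si_zero, SiPoly_zero] using hm self_mem_Ici hx hx

/-- Consecutive Taylor polynomials lie on opposite sides of `Si`, so the error is at most the first
omitted term. -/
theorem abs_Si_sub_SiPoly_le (N : ℕ) {x : ℝ} (hx : 0 ≤ x) :
    |Si x - SiPoly (N + 1) x| ≤
      x ^ (2 * (N + 1) + 1) / ((2 * (N + 1) + 1) * (2 * (N + 1) + 1).factorial) := by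
  have h1 := Si_remainder_nonneg N hx
  have h2 := Si_remainder_nonneg (N + 1) hx
  have h3 : SiPoly (N + 1 + 1) x = SiPoly (N + 1) x + (-1) ^ (N + 1) *
      (x ^ (2 * (N + 1) + 1) / ((2 * (N + 1) + 1) * (2 * (N + 1) + 1).factorial)) := by
    simp only [SiPoly]
    rw [Finset.sum_range_succ]
    push_cast
    ring
  have h4 : |Si x - SiPoly (N + 1) x| = (-1) ^ (N + 1) * (Si x - SiPoly (N + 1) x) := by
    rw [← abs_of_nonneg h1, abs_mul, abs_pow, abs_neg, abs_one, one_pow, one_mul]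
  rw [h4]
  rw [h3, pow_succ (-1 : ℝ) (N + 1)] at h2
  have h5 : (-1 : ℝ) ^ (N + 1) * (-1) ^ (N + 1) = 1 := by
    rw [← mul_pow]; simp
  nlinarith

/-- Three errors add up: replacing x by a rational r (`Si` is 1-Lipschitz), truncating the series,
and rounding the value of the polynomial. -/
theorem Si_approx (N : ℕ) {x r v δ : ℝ} (hr : 0 ≤ r) (hx : |x - r| ≤ δ)
    (hv : |SiPoly (N + 1) r - v| ≤ δ)
    (ht : r ^ (2 * (N + 1) + 1) / ((2 * (N + 1) + 1) * (2 * (N + 1) + 1).factorial) ≤ δ) :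
    |Si x - v| ≤ 3 * δ := by
  have h1 := (abs_Si_sub_le x r).trans hx
  have h2 := (abs_Si_sub_SiPoly_le N hr).trans ht
  calc |Si x - v| = |(Si x - Si r) + (Si r - SiPoly (N + 1) r) + (SiPoly (N + 1) r - v)| := by
        congr 1; ring
    _ ≤ |Si x - Si r| + |Si r - SiPoly (N + 1) r| + |SiPoly (N + 1) r - v| := abs_add_three _ _ _
    _ ≤ 3 * δ := by linarith

/-! ### The building blocks `cos (2πz) / (q² - z²)` -/

/-- The entire function extending `cos (2πz) / (q² - z²)`, for `q` a zero of `cos (2πz)`. -/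
noncomputable def kern (q z : ℝ) : ℝ :=
  sin (2 * π * q) * (π / q) * (sinc (2 * π * (z + q)) + sinc (2 * π * (z - q)))

/-- The odd primitive of `kern q`. -/
noncomputable def kernPrim (q z : ℝ) : ℝ :=
  sin (2 * π * q) / (2 * q) * (Si (2 * π * (z + q)) + Si (2 * π * (z - q)))

theorem mul_sinc (x : ℝ) : x * sinc x = sin x := by
  rcases eq_or_ne x 0 with rfl | hx
  · simp
  · rw [sinc_of_ne_zero hx]; field_simp

/-- Since cos(2πq) = 0, sin(2π(z ± q)) = ± sin(2πq) cos(2πz); the two `sinc` terms are then the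
partial fractions of 1/(q² - z²). -/
theorem kern_mul {q : ℝ} (hq : q ≠ 0) (hc : cos (2 * π * q) = 0) (z : ℝ) :
    (q ^ 2 - z ^ 2) * kern q z = cos (2 * π * z) := by
  have hA := mul_sinc (2 * π * (z + q))
  have hB := mul_sinc (2 * π * (z - q))
  rw [mul_add, sin_add, hc, mul_zero, zero_add] at hA
  rw [mul_sub, sin_sub, hc, mul_zero, zero_sub] at hB
  rw [← mul_add] at hA
  rw [← mul_sub] at hB
  have hs := sin_sq_add_cos_sq (2 * π * q)
  rw [hc] at hs
  unfold kern
  set s := sin (2 * π * q)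
  set u := sinc (2 * π * (z + q))
  set v := sinc (2 * π * (z - q))
  set c := cos (2 * π * z)
  field_simp
  linear_combination (-s * (z - q) / 2) * hA + (-s * (z + q) / 2) * hB + c * q * hs

theorem continuous_kern (q : ℝ) : Continuous (kern q) := by
  have := continuous_sinc
  unfold kern
  fun_prop

theorem kern_neg (q z : ℝ) : kern q (-z) = kern q z := by
  unfold kern
  rw [show 2 * π * (-z + q) = -(2 * π * (z - q)) by ring,
    show 2 * π * (-z - q) = -(2 * π * (z + q)) by ring, sinc_neg, sinc_neg]
  ring

theorem hasDerivAt_kernPrim {q : ℝ} (hq : q ≠ 0) (z : ℝ) :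
    HasDerivAt (kernPrim q) (kern q z) z := by
  have h1 := (hasDerivAt_Si (2 * π * (z + q))).comp z
    (((hasDerivAt_id z).add_const q).const_mul (2 * π))
  have h2 := (hasDerivAt_Si (2 * π * (z - q))).comp z
    (((hasDerivAt_id z).sub_const q).const_mul (2 * π))
  refine ((h1.add h2).const_mul (sin (2 * π * q) / (2 * q))).congr_deriv ?_
  unfold kern
  field_simp

theorem continuous_kernPrim (q : ℝ) : Continuous (kernPrim q) := by
  have := continuous_Si
  unfold kernPrim
  fun_prop

theorem kernPrim_zero (q : ℝ) : kernPrim q 0 = 0 := by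
  unfold kernPrim
  rw [show 2 * π * (0 - q) = -(2 * π * (0 + q)) by ring, Si_neg]
  ring

theorem abs_kern_le {q : ℝ} (hq : 0 < q) (hq' : q ≤ 5 / 4) (hq4 : 1 / 4 ≤ q)
    (hc : cos (2 * π * q) = 0) (z : ℝ) :
    |kern q z| ≤ 160 * (1 + z ^ 2)⁻¹ := by
  rw [← div_eq_mul_inv, le_div_iff₀ (by positivity)]
  -- For |z| < 2 the trivial bound 32 times 1 + z² < 5 gives 160; beyond that, q ≤ 5/4 keeps z² - q²
  -- comparable with 1 + z².
  by_cases hz : z ^ 2 < 4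
  · have h1 : |kern q z| ≤ 32 := by
      have h2 : |sinc (2 * π * (z + q)) + sinc (2 * π * (z - q))| ≤ 2 :=
        (abs_add_le _ _).trans
          ((add_le_add (abs_sinc_le_one _) (abs_sinc_le_one _)).trans (by norm_num))
      have h3 : π / q ≤ 16 := by
        rw [div_le_iff₀ hq]; linarith [pi_lt_four]
      unfold kern
      rw [abs_mul, abs_mul, abs_of_pos (div_pos pi_pos hq)]
      have h4 := abs_sin_le_one (2 * π * q)
      have h5 := div_pos pi_pos hq
      calc _ ≤ 1 * 16 * (2 : ℝ) := by gcongr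
        _ = 32 := by norm_num
    nlinarith [abs_nonneg (kern q z)]
  · have h := kern_mul hq.ne' hc z
    have h1 : |q ^ 2 - z ^ 2| * |kern q z| ≤ 1 := by
      rw [← abs_mul, h]; exact abs_cos_le_one _
    have h2 : |q ^ 2 - z ^ 2| = z ^ 2 - q ^ 2 := by
      rw [abs_sub_comm]; exact abs_of_nonneg (by nlinarith)
    rw [h2] at h1
    have h3 : 1 + z ^ 2 ≤ 160 * (z ^ 2 - q ^ 2) := by nlinarith
    nlinarith [mul_le_mul_of_nonneg_left h3 (abs_nonneg (kern q z))]

/-! ### Moment kernels attached to the zeros 1/4, 3/4, 5/4 -/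

theorem sin_half_pi_three : sin (2 * π * (3 / 4)) = -1 := by
  rw [show 2 * π * (3 / 4) = π / 2 + π by ring, sin_add_pi, sin_pi_div_two]

theorem sin_half_pi_one : sin (2 * π * (1 / 4)) = 1 := by
  rw [show 2 * π * (1 / 4) = π / 2 by ring, sin_pi_div_two]

theorem sin_half_pi_five : sin (2 * π * (5 / 4)) = 1 := by
  rw [show 2 * π * (5 / 4) = π / 2 + 2 * π by ring, sin_add_two_pi, sin_pi_div_two]

theorem cos_half_pi_three : cos (2 * π * (3 / 4)) = 0 := by
  rw [show 2 * π * (3 / 4) = π / 2 + π by ring, cos_add_pi, cos_pi_div_two, neg_zero]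

theorem cos_half_pi_one : cos (2 * π * (1 / 4)) = 0 := by
  rw [show 2 * π * (1 / 4) = π / 2 by ring, cos_pi_div_two]

theorem cos_half_pi_five : cos (2 * π * (5 / 4)) = 0 := by
  rw [show 2 * π * (5 / 4) = π / 2 + 2 * π by ring, cos_add_two_pi, cos_pi_div_two]

/-- The combination with coefficients `qₖ^(2i) / ∏_{j ≠ k} (q_j² - q_k²)`; for `i ≤ 2` it
extends `z^(2i) cos (2πz) / ∏ⱼ (q_j² - z²)`. -/
noncomputable def momKern (i : ℕ) (z : ℝ) : ℝ :=
  4 / 3 * (1 / 16) ^ i * kern (1 / 4) z - 2 * (9 / 16) ^ i * kern (3 / 4) z +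
    2 / 3 * (25 / 16) ^ i * kern (5 / 4) z

/-- The odd primitive of `momKern i`. -/
noncomputable def momPrim (i : ℕ) (z : ℝ) : ℝ :=
  4 / 3 * (1 / 16) ^ i * kernPrim (1 / 4) z - 2 * (9 / 16) ^ i * kernPrim (3 / 4) z +
    2 / 3 * (25 / 16) ^ i * kernPrim (5 / 4) z

theorem continuous_momKern (i : ℕ) : Continuous (momKern i) := by
  have h := continuous_kern
  unfold momKern
  fun_prop

theorem continuous_momPrim (i : ℕ) : Continuous (momPrim i) := by
  have h := continuous_kernPrim
  unfold momPrim
  fun_prop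

theorem momKern_neg (i : ℕ) (z : ℝ) : momKern i (-z) = momKern i z := by
  simp [momKern, kern_neg]

theorem momPrim_zero (i : ℕ) : momPrim i 0 = 0 := by
  simp [momPrim, kernPrim_zero]

theorem hasDerivAt_momPrim (i : ℕ) (z : ℝ) : HasDerivAt (momPrim i) (momKern i z) z :=
  (((hasDerivAt_kernPrim (by norm_num) z).const_mul _).sub
    ((hasDerivAt_kernPrim (by norm_num) z).const_mul _)).add
    ((hasDerivAt_kernPrim (by norm_num) z).const_mul _)

theorem integral_momKern (i : ℕ) (a b : ℝ) :
    ∫ z in a..b, momKern i z = momPrim i b - momPrim i a :=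
  intervalIntegral.integral_eq_sub_of_hasDerivAt (fun z _ => hasDerivAt_momPrim i z)
    ((continuous_momKern i).intervalIntegrable _ _)

theorem kern_one_mul (z : ℝ) : (1 / 16 - z ^ 2) * kern (1 / 4) z = cos (2 * π * z) := by
  rw [← kern_mul (by norm_num) cos_half_pi_one z]; norm_num

theorem kern_three_mul (z : ℝ) : (9 / 16 - z ^ 2) * kern (3 / 4) z = cos (2 * π * z) := by
  rw [← kern_mul (by norm_num) cos_half_pi_three z]; norm_num

theorem kern_five_mul (z : ℝ) : (25 / 16 - z ^ 2) * kern (5 / 4) z = cos (2 * π * z) := by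
  rw [← kern_mul (by norm_num) cos_half_pi_five z]; norm_num

/-- With c = (4/3, -2, 2/3), replacing q_k² by z² in the coefficients changes the sum by cos(2πz) ∑
c_k = 0. The next moment uses also ∑ c_k q_k² = 0. -/
theorem momKern_one (z : ℝ) : momKern 1 z = z ^ 2 * momKern 0 z := by
  unfold momKern
  linear_combination 4 / 3 * kern_one_mul z - 2 * kern_three_mul z + 2 / 3 * kern_five_mul z

theorem momKern_two (z : ℝ) : momKern 2 z = z ^ 4 * momKern 0 z := by
  unfold momKern
  linear_combination (4 / 3 * (1 / 16 + z ^ 2)) * kern_one_mul z -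
    (2 * (9 / 16 + z ^ 2)) * kern_three_mul z + (2 / 3 * (25 / 16 + z ^ 2)) * kern_five_mul z

theorem momKern_zero_mul (z : ℝ) :
    (1 / 16 - z ^ 2) * (9 / 16 - z ^ 2) * (25 / 16 - z ^ 2) * momKern 0 z = cos (2 * π * z) := by
  unfold momKern
  linear_combination
    4 / 3 * (9 / 16 - z ^ 2) * (25 / 16 - z ^ 2) * kern_one_mul z -
    2 * (1 / 16 - z ^ 2) * (25 / 16 - z ^ 2) * kern_three_mul z +
    2 / 3 * (1 / 16 - z ^ 2) * (9 / 16 - z ^ 2) * kern_five_mul z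

theorem cos_two_pi_pos_of_lt {z : ℝ} (h0 : 0 ≤ z) (h1 : z < 1 / 4) : 0 < cos (2 * π * z) :=
  cos_pos_of_mem_Ioo ⟨by nlinarith [pi_pos], by nlinarith [pi_pos]⟩

theorem cos_two_pi_neg_of_mem {z : ℝ} (h0 : 1 / 4 < z) (h1 : z < 3 / 4) : cos (2 * π * z) < 0 :=
  cos_neg_of_pi_div_two_lt_of_lt (by nlinarith [pi_pos]) (by nlinarith [pi_pos])

theorem cos_two_pi_pos_of_mem {z : ℝ} (h0 : 3 / 4 < z) (h1 : z < 5 / 4) : 0 < cos (2 * π * z) := by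
  rw [← cos_sub_two_pi]
  exact cos_pos_of_mem_Ioo ⟨by nlinarith [pi_pos], by nlinarith [pi_pos]⟩

theorem cos_two_pi_neg_of_mem' {z : ℝ} (h0 : 5 / 4 < z) (h1 : z < 7 / 4) : cos (2 * π * z) < 0 := by
  rw [← cos_sub_two_pi]
  exact cos_neg_of_pi_div_two_lt_of_lt (by nlinarith [pi_pos]) (by nlinarith [pi_pos])

theorem kern_self_sign {q : ℝ} (hq : 0 < q) : 0 ≤ sin (2 * π * q) * kern q q := by
  unfold kern
  have h := neg_one_le_sinc (2 * π * (q + q))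
  rw [sub_self, mul_zero, sinc_zero, ← mul_assoc, ← mul_assoc]
  have h2 : 0 < π / q := div_pos pi_pos hq
  have h3 := mul_self_nonneg (sin (2 * π * q))
  have : 0 ≤ sinc (2 * π * (q + q)) + 1 := by linarith
  positivity

/-- On this range cos(2πz) and ∏ (q_j² - z²) change sign at the same points. At such a point q_k
only the k-th kernel survives, and its value has the sign of its coefficient. -/
theorem momKern_zero_nonneg {z : ℝ} (h0 : 0 ≤ z) (h1 : z < 7 / 4) : 0 ≤ momKern 0 z := by
  have h := momKern_zero_mul z
  rcases lt_trichotomy z (1 / 4) with hz | rfl | hz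
  · have hc := cos_two_pi_pos_of_lt h0 hz
    have : 0 < (1 / 16 - z ^ 2) * (9 / 16 - z ^ 2) * (25 / 16 - z ^ 2) :=
      mul_pos (mul_pos (by nlinarith) (by nlinarith)) (by nlinarith)
    exact (pos_of_mul_pos_right (h ▸ hc) this.le).le
  · have e1 := kern_three_mul (1 / 4)
    have e2 := kern_five_mul (1 / 4)
    have e3 := kern_self_sign (q := 1 / 4) (by norm_num)
    rw [cos_half_pi_one] at e1 e2
    rw [sin_half_pi_one] at e3
    unfold momKern
    linarith
  rcases lt_trichotomy z (3 / 4) with hz' | rfl | hz'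
  · have hc := cos_two_pi_neg_of_mem hz hz'
    have : (1 / 16 - z ^ 2) * (9 / 16 - z ^ 2) * (25 / 16 - z ^ 2) < 0 :=
      mul_neg_of_neg_of_pos (mul_neg_of_neg_of_pos (by nlinarith) (by nlinarith)) (by nlinarith)
    nlinarith
  · have e1 := kern_one_mul (3 / 4)
    have e2 := kern_five_mul (3 / 4)
    have e3 := kern_self_sign (q := 3 / 4) (by norm_num)
    rw [cos_half_pi_three] at e1 e2
    rw [sin_half_pi_three] at e3
    unfold momKern
    linarith
  rcases lt_trichotomy z (5 / 4) with hz'' | rfl | hz''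
  · have hc := cos_two_pi_pos_of_mem hz' hz''
    have : 0 < (1 / 16 - z ^ 2) * (9 / 16 - z ^ 2) * (25 / 16 - z ^ 2) :=
      mul_pos (mul_pos_of_neg_of_neg (by nlinarith) (by nlinarith)) (by nlinarith)
    exact (pos_of_mul_pos_right (h ▸ hc) this.le).le
  · have e1 := kern_one_mul (5 / 4)
    have e2 := kern_three_mul (5 / 4)
    have e3 := kern_self_sign (q := 5 / 4) (by norm_num)
    rw [cos_half_pi_five] at e1 e2
    rw [sin_half_pi_five] at e3
    unfold momKern
    linarith
  · have hc := cos_two_pi_neg_of_mem' hz'' h1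
    have : (1 / 16 - z ^ 2) * (9 / 16 - z ^ 2) * (25 / 16 - z ^ 2) < 0 :=
      mul_neg_of_pos_of_neg (mul_pos_of_neg_of_neg (by nlinarith) (by nlinarith)) (by nlinarith)
    nlinarith

/-- The functional `∫_0^{q₁} + ∫_{q₂}^{q₃} - ∫_{z₁}^{z₂}` applied to `momKern i`. -/
noncomputable def momFun (i : ℕ) (z₁ z₂ : ℝ) : ℝ :=
  momPrim i (1 / 4) + (momPrim i (5 / 4) - momPrim i (3 / 4)) - (momPrim i z₂ - momPrim i z₁)

/-! ### Numerical values -/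

/-- Here r is a decimal rounding of 2πc, and 6.2831853071795 and 6.2831853071796 enclose 2π.
Twenty-nine Taylor terms suffice for the arguments used, the largest being 5π. -/
theorem Si_two_pi_approx {c r v : ℝ} (hr : 0 ≤ r) (hc : 0 ≤ c)
    (h1 : r - 9 / 10 ^ 11 ≤ 6.2831853071795 * c) (h2 : 6.2831853071796 * c ≤ r + 9 / 10 ^ 11)
    (hv : |SiPoly 29 r - v| ≤ 1 / 10 ^ 10)
    (ht : r ^ 59 / (59 * (59 : ℕ).factorial) ≤ 1 / 10 ^ 10) :
    |Si (2 * π * c) - v| ≤ 3 / 10 ^ 10 := by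
  refine (Si_approx 28 hr ?_ hv ?_).trans (by norm_num)
  · have h3 := pi_gt_d20
    have h4 := pi_lt_d20
    rw [abs_le]
    constructor <;> nlinarith
  · convert ht using 2
    norm_num

theorem Si_two_pi_approx_neg {c r v : ℝ} (hr : 0 ≤ r) (hc : c ≤ 0)
    (h1 : r - 9 / 10 ^ 11 ≤ 6.2831853071795 * -c) (h2 : 6.2831853071796 * -c ≤ r + 9 / 10 ^ 11)
    (hv : |SiPoly 29 r - v| ≤ 1 / 10 ^ 10)
    (ht : r ^ 59 / (59 * (59 : ℕ).factorial) ≤ 1 / 10 ^ 10) :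
    |Si (2 * π * c) - -v| ≤ 3 / 10 ^ 10 := by
  have h := Si_two_pi_approx hr (neg_nonneg.2 hc) h1 h2 hv ht
  rw [mul_neg, Si_neg] at h
  rwa [show Si (2 * π * c) - -v = -(-Si (2 * π * c) - v) by ring, abs_neg]

theorem kernPrim_one (z : ℝ) : kernPrim (1 / 4) z =
    2 * (Si (2 * π * (z + 1 / 4)) + Si (2 * π * (z - 1 / 4))) := by
  rw [kernPrim, sin_half_pi_one]; norm_num

theorem kernPrim_three (z : ℝ) : kernPrim (3 / 4) z =
    -(2 / 3) * (Si (2 * π * (z + 3 / 4)) + Si (2 * π * (z - 3 / 4))) := by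
  rw [kernPrim, sin_half_pi_three]; norm_num

theorem kernPrim_five (z : ℝ) : kernPrim (5 / 4) z =
    2 / 5 * (Si (2 * π * (z + 5 / 4)) + Si (2 * π * (z - 5 / 4))) := by
  rw [kernPrim, sin_half_pi_five]; norm_num

theorem momPrim_left_lower :
    |momPrim 0 0.7209645 - 10.606373617| ≤ 1 / 10 ^ 8 ∧
    |momPrim 1 0.7209645 - 1.515475720| ≤ 1 / 10 ^ 8 ∧
    |momPrim 2 0.7209645 - 0.432949698| ≤ 1 / 10 ^ 8 := by
  have h1 : |Si (2 * π * (0.7209645 + 1 / 4)) - 1.4208450267| ≤ 3 / 10 ^ 10 := by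
    refine Si_two_pi_approx (r := 6.1007498802) ?_ ?_ ?_ ?_ ?_ ?_ <;>
      norm_num [abs_le, SiPoly, Finset.sum_range_succ, Nat.factorial]
  have h2 : |Si (2 * π * (0.7209645 - 1 / 4)) - 1.8464409004| ≤ 3 / 10 ^ 10 := by
    refine Si_two_pi_approx (r := 2.9591572266) ?_ ?_ ?_ ?_ ?_ ?_ <;>
      norm_num [abs_le, SiPoly, Finset.sum_range_succ, Nat.factorial]
  have h3 : |Si (2 * π * (0.7209645 + 3 / 4)) - 1.6729779447| ≤ 3 / 10 ^ 10 := by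
    refine Si_two_pi_approx (r := 9.2423425338) ?_ ?_ ?_ ?_ ?_ ?_ <;>
      norm_num [abs_le, SiPoly, Finset.sum_range_succ, Nat.factorial]
  have h4 : |Si (2 * π * (0.7209645 - 3 / 4)) - -0.1820984336| ≤ 3 / 10 ^ 10 := by
    refine Si_two_pi_approx_neg (r := 0.1824354270) ?_ ?_ ?_ ?_ ?_ ?_ <;>
      norm_num [abs_le, SiPoly, Finset.sum_range_succ, Nat.factorial]
  have h5 : |Si (2 * π * (0.7209645 + 5 / 4)) - 1.4934947477| ≤ 3 / 10 ^ 10 := by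
    refine Si_two_pi_approx (r := 12.3839351874) ?_ ?_ ?_ ?_ ?_ ?_ <;>
      norm_num [abs_le, SiPoly, Finset.sum_range_succ, Nat.factorial]
  have h6 : |Si (2 * π * (0.7209645 - 5 / 4)) - -1.8468505097| ≤ 3 / 10 ^ 10 := by
    refine Si_two_pi_approx_neg (r := 3.3240280806) ?_ ?_ ?_ ?_ ?_ ?_ <;>
      norm_num [abs_le, SiPoly, Finset.sum_range_succ, Nat.factorial]
  rw [abs_le] at h1 h2 h3 h4 h5 h6
  simp only [momPrim, kernPrim_one, kernPrim_three, kernPrim_five, abs_le]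
  refine ⟨⟨?_, ?_⟩, ⟨?_, ?_⟩, ⟨?_, ?_⟩⟩ <;>
    linarith [h1.1, h1.2, h2.1, h2.2, h3.1, h3.2, h4.1, h4.2, h5.1, h5.2, h6.1, h6.2]

theorem momPrim_left_upper :
    |momPrim 0 0.7209649 - 10.606377181| ≤ 1 / 10 ^ 8 ∧
    |momPrim 1 0.7209649 - 1.515477573| ≤ 1 / 10 ^ 8 ∧
    |momPrim 2 0.7209649 - 0.432950661| ≤ 1 / 10 ^ 8 := by
  have h1 : |Si (2 * π * (0.7209649 + 1 / 4)) - 1.4208449519| ≤ 3 / 10 ^ 10 := by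
    refine Si_two_pi_approx (r := 6.1007523935) ?_ ?_ ?_ ?_ ?_ ?_ <;>
      norm_num [abs_le, SiPoly, Finset.sum_range_succ, Nat.factorial]
  have h2 : |Si (2 * π * (0.7209649 - 1 / 4)) - 1.8464410545| ≤ 3 / 10 ^ 10 := by
    refine Si_two_pi_approx (r := 2.9591597399) ?_ ?_ ?_ ?_ ?_ ?_ <;>
      norm_num [abs_le, SiPoly, Finset.sum_range_succ, Nat.factorial]
  have h3 : |Si (2 * π * (0.7209649 + 3 / 4)) - 1.6729779941| ≤ 3 / 10 ^ 10 := by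
    refine Si_two_pi_approx (r := 9.2423450471) ?_ ?_ ?_ ?_ ?_ ?_ <;>
      norm_num [abs_le, SiPoly, Finset.sum_range_succ, Nat.factorial]
  have h4 : |Si (2 * π * (0.7209649 - 3 / 4)) - -0.1820959342| ≤ 3 / 10 ^ 10 := by
    refine Si_two_pi_approx_neg (r := 0.1824329137) ?_ ?_ ?_ ?_ ?_ ?_ <;>
      norm_num [abs_le, SiPoly, Finset.sum_range_succ, Nat.factorial]
  have h5 : |Si (2 * π * (0.7209649 + 5 / 4)) - 1.4934947109| ≤ 3 / 10 ^ 10 := by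
    refine Si_two_pi_approx (r := 12.3839377006) ?_ ?_ ?_ ?_ ?_ ?_ <;>
      norm_num [abs_le, SiPoly, Finset.sum_range_succ, Nat.factorial]
  have h6 : |Si (2 * π * (0.7209649 - 5 / 4)) - -1.8468506469| ≤ 3 / 10 ^ 10 := by
    refine Si_two_pi_approx_neg (r := 3.3240255673) ?_ ?_ ?_ ?_ ?_ ?_ <;>
      norm_num [abs_le, SiPoly, Finset.sum_range_succ, Nat.factorial]
  rw [abs_le] at h1 h2 h3 h4 h5 h6
  simp only [momPrim, kernPrim_one, kernPrim_three, kernPrim_five, abs_le]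
  refine ⟨⟨?_, ?_⟩, ⟨?_, ?_⟩, ⟨?_, ?_⟩⟩ <;>
    linarith [h1.1, h1.2, h2.1, h2.2, h3.1, h3.2, h4.1, h4.2, h5.1, h5.2, h6.1, h6.2]

theorem momPrim_right_lower :
    |momPrim 0 1.233059 - 13.112789285| ≤ 1 / 10 ^ 8 ∧
    |momPrim 1 1.233059 - 3.658911852| ≤ 1 / 10 ^ 8 ∧
    |momPrim 2 1.233059 - 2.436713983| ≤ 1 / 10 ^ 8 := by
  have h1 : |Si (2 * π * (1.233059 + 1 / 4)) - 1.6741567209| ≤ 3 / 10 ^ 10 := by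
    refine Si_two_pi_approx (r := 9.3183345185) ?_ ?_ ?_ ?_ ?_ ?_ <;>
      norm_num [abs_le, SiPoly, Finset.sum_range_succ, Nat.factorial]
  have h2 : |Si (2 * π * (1.233059 - 1 / 4)) - 1.4190626568| ≤ 3 / 10 ^ 10 := by
    refine Si_two_pi_approx (r := 6.1767418649) ?_ ?_ ?_ ?_ ?_ ?_ <;>
      norm_num [abs_le, SiPoly, Finset.sum_range_succ, Nat.factorial]
  have h3 : |Si (2 * π * (1.233059 + 3 / 4)) - 1.4926141738| ≤ 3 / 10 ^ 10 := by
    refine Si_two_pi_approx (r := 12.4599271721) ?_ ?_ ?_ ?_ ?_ ?_ <;>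
      norm_num [abs_le, SiPoly, Finset.sum_range_succ, Nat.factorial]
  have h4 : |Si (2 * π * (1.233059 - 3 / 4)) - 1.8500937471| ≤ 3 / 10 ^ 10 := by
    refine Si_two_pi_approx (r := 3.0351492113) ?_ ?_ ?_ ?_ ?_ ?_ <;>
      norm_num [abs_le, SiPoly, Finset.sum_range_succ, Nat.factorial]
  have h5 : |Si (2 * π * (1.233059 + 5 / 4)) - 1.6336028991| ≤ 3 / 10 ^ 10 := by
    refine Si_two_pi_approx (r := 15.6015198257) ?_ ?_ ?_ ?_ ?_ ?_ <;>
      norm_num [abs_le, SiPoly, Finset.sum_range_succ, Nat.factorial]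
  have h6 : |Si (2 * π * (1.233059 - 5 / 4)) - -0.1063764636| ≤ 3 / 10 ^ 10 := by
    refine Si_two_pi_approx_neg (r := 0.1064434423) ?_ ?_ ?_ ?_ ?_ ?_ <;>
      norm_num [abs_le, SiPoly, Finset.sum_range_succ, Nat.factorial]
  rw [abs_le] at h1 h2 h3 h4 h5 h6
  simp only [momPrim, kernPrim_one, kernPrim_three, kernPrim_five, abs_le]
  refine ⟨⟨?_, ?_⟩, ⟨?_, ?_⟩, ⟨?_, ?_⟩⟩ <;>
    linarith [h1.1, h1.2, h2.1, h2.2, h3.1, h3.2, h4.1, h4.2, h5.1, h5.2, h6.1, h6.2]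

theorem momPrim_right_upper :
    |momPrim 0 1.2330599 - 13.112790912| ≤ 1 / 10 ^ 8 ∧
    |momPrim 1 1.2330599 - 3.658914326| ≤ 1 / 10 ^ 8 ∧
    |momPrim 2 1.2330599 - 2.436717746| ≤ 1 / 10 ^ 8 := by
  have h1 : |Si (2 * π * (1.2330599 + 1 / 4)) - 1.6741567854| ≤ 3 / 10 ^ 10 := by
    refine Si_two_pi_approx (r := 9.3183401733) ?_ ?_ ?_ ?_ ?_ ?_ <;>
      norm_num [abs_le, SiPoly, Finset.sum_range_succ, Nat.factorial]
  have h2 : |Si (2 * π * (1.2330599 - 1 / 4)) - 1.4190625595| ≤ 3 / 10 ^ 10 := by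
    refine Si_two_pi_approx (r := 6.1767475198) ?_ ?_ ?_ ?_ ?_ ?_ <;>
      norm_num [abs_le, SiPoly, Finset.sum_range_succ, Nat.factorial]
  have h3 : |Si (2 * π * (1.2330599 + 3 / 4)) - 1.4926141256| ≤ 3 / 10 ^ 10 := by
    refine Si_two_pi_approx (r := 12.4599328269) ?_ ?_ ?_ ?_ ?_ ?_ <;>
      norm_num [abs_le, SiPoly, Finset.sum_range_succ, Nat.factorial]
  have h4 : |Si (2 * π * (1.2330599 - 3 / 4)) - 1.8500939451| ≤ 3 / 10 ^ 10 := by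
    refine Si_two_pi_approx (r := 3.0351548662) ?_ ?_ ?_ ?_ ?_ ?_ <;>
      norm_num [abs_le, SiPoly, Finset.sum_range_succ, Nat.factorial]
  have h5 : |Si (2 * π * (1.2330599 + 5 / 4)) - 1.6336029376| ≤ 3 / 10 ^ 10 := by
    refine Si_two_pi_approx (r := 15.6015254805) ?_ ?_ ?_ ?_ ?_ ?_ <;>
      norm_num [abs_le, SiPoly, Finset.sum_range_succ, Nat.factorial]
  have h6 : |Si (2 * π * (1.2330599 - 5 / 4)) - -0.1063708194| ≤ 3 / 10 ^ 10 := by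
    refine Si_two_pi_approx_neg (r := 0.1064377874) ?_ ?_ ?_ ?_ ?_ ?_ <;>
      norm_num [abs_le, SiPoly, Finset.sum_range_succ, Nat.factorial]
  rw [abs_le] at h1 h2 h3 h4 h5 h6
  simp only [momPrim, kernPrim_one, kernPrim_three, kernPrim_five, abs_le]
  refine ⟨⟨?_, ?_⟩, ⟨?_, ?_⟩, ⟨?_, ?_⟩⟩ <;>
    linarith [h1.1, h1.2, h2.1, h2.2, h3.1, h3.2, h4.1, h4.2, h5.1, h5.2, h6.1, h6.2]

theorem momPrim_first_zero :
    |momPrim 0 (1 / 4) - 4.428547564| ≤ 1 / 10 ^ 8 ∧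
    |momPrim 1 (1 / 4) - 0.090237995| ≤ 1 / 10 ^ 8 ∧
    |momPrim 2 (1 / 4) - 0.003351711| ≤ 1 / 10 ^ 8 := by
  have h1 : |Si (2 * π * ((1 / 4) + 1 / 4)) - 1.8519370520| ≤ 3 / 10 ^ 10 := by
    refine Si_two_pi_approx (r := 3.1415926536) ?_ ?_ ?_ ?_ ?_ ?_ <;>
      norm_num [abs_le, SiPoly, Finset.sum_range_succ, Nat.factorial]
  have h2 : |Si (2 * π * ((1 / 4) - 1 / 4)) - 0E-10| ≤ 3 / 10 ^ 10 := by
    refine Si_two_pi_approx (r := 0E-10) ?_ ?_ ?_ ?_ ?_ ?_ <;>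
      norm_num [abs_le, SiPoly, Finset.sum_range_succ, Nat.factorial]
  have h3 : |Si (2 * π * ((1 / 4) + 3 / 4)) - 1.4181515761| ≤ 3 / 10 ^ 10 := by
    refine Si_two_pi_approx (r := 6.2831853072) ?_ ?_ ?_ ?_ ?_ ?_ <;>
      norm_num [abs_le, SiPoly, Finset.sum_range_succ, Nat.factorial]
  have h4 : |Si (2 * π * ((1 / 4) - 3 / 4)) - -1.8519370520| ≤ 3 / 10 ^ 10 := by
    refine Si_two_pi_approx_neg (r := 3.1415926536) ?_ ?_ ?_ ?_ ?_ ?_ <;>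
      norm_num [abs_le, SiPoly, Finset.sum_range_succ, Nat.factorial]
  have h5 : |Si (2 * π * ((1 / 4) + 5 / 4)) - 1.6747617990| ≤ 3 / 10 ^ 10 := by
    refine Si_two_pi_approx (r := 9.4247779608) ?_ ?_ ?_ ?_ ?_ ?_ <;>
      norm_num [abs_le, SiPoly, Finset.sum_range_succ, Nat.factorial]
  have h6 : |Si (2 * π * ((1 / 4) - 5 / 4)) - -1.4181515761| ≤ 3 / 10 ^ 10 := by
    refine Si_two_pi_approx_neg (r := 6.2831853072) ?_ ?_ ?_ ?_ ?_ ?_ <;>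
      norm_num [abs_le, SiPoly, Finset.sum_range_succ, Nat.factorial]
  rw [abs_le] at h1 h2 h3 h4 h5 h6
  simp only [momPrim, kernPrim_one, kernPrim_three, kernPrim_five, abs_le]
  refine ⟨⟨?_, ?_⟩, ⟨?_, ?_⟩, ⟨?_, ?_⟩⟩ <;>
    linarith [h1.1, h1.2, h2.1, h2.2, h3.1, h3.2, h4.1, h4.2, h5.1, h5.2, h6.1, h6.2]

theorem momPrim_second_zero :
    |momPrim 0 (3 / 4) - 10.857311853| ≤ 1 / 10 ^ 8 ∧
    |momPrim 1 (3 / 4) - 1.651179526| ≤ 1 / 10 ^ 8 ∧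
    |momPrim 2 (3 / 4) - 0.506374504| ≤ 1 / 10 ^ 8 := by
  have h1 : |Si (2 * π * ((3 / 4) + 1 / 4)) - 1.4181515761| ≤ 3 / 10 ^ 10 := by
    refine Si_two_pi_approx (r := 6.2831853072) ?_ ?_ ?_ ?_ ?_ ?_ <;>
      norm_num [abs_le, SiPoly, Finset.sum_range_succ, Nat.factorial]
  have h2 : |Si (2 * π * ((3 / 4) - 1 / 4)) - 1.8519370520| ≤ 3 / 10 ^ 10 := by
    refine Si_two_pi_approx (r := 3.1415926536) ?_ ?_ ?_ ?_ ?_ ?_ <;>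
      norm_num [abs_le, SiPoly, Finset.sum_range_succ, Nat.factorial]
  have h3 : |Si (2 * π * ((3 / 4) + 3 / 4)) - 1.6747617990| ≤ 3 / 10 ^ 10 := by
    refine Si_two_pi_approx (r := 9.4247779608) ?_ ?_ ?_ ?_ ?_ ?_ <;>
      norm_num [abs_le, SiPoly, Finset.sum_range_succ, Nat.factorial]
  have h4 : |Si (2 * π * ((3 / 4) - 3 / 4)) - 0E-10| ≤ 3 / 10 ^ 10 := by
    refine Si_two_pi_approx (r := 0E-10) ?_ ?_ ?_ ?_ ?_ ?_ <;>
      norm_num [abs_le, SiPoly, Finset.sum_range_succ, Nat.factorial]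
  have h5 : |Si (2 * π * ((3 / 4) + 5 / 4)) - 1.4921612256| ≤ 3 / 10 ^ 10 := by
    refine Si_two_pi_approx (r := 12.5663706144) ?_ ?_ ?_ ?_ ?_ ?_ <;>
      norm_num [abs_le, SiPoly, Finset.sum_range_succ, Nat.factorial]
  have h6 : |Si (2 * π * ((3 / 4) - 5 / 4)) - -1.8519370520| ≤ 3 / 10 ^ 10 := by
    refine Si_two_pi_approx_neg (r := 3.1415926536) ?_ ?_ ?_ ?_ ?_ ?_ <;>
      norm_num [abs_le, SiPoly, Finset.sum_range_succ, Nat.factorial]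
  rw [abs_le] at h1 h2 h3 h4 h5 h6
  simp only [momPrim, kernPrim_one, kernPrim_three, kernPrim_five, abs_le]
  refine ⟨⟨?_, ?_⟩, ⟨?_, ?_⟩, ⟨?_, ?_⟩⟩ <;>
    linarith [h1.1, h1.2, h2.1, h2.2, h3.1, h3.2, h4.1, h4.2, h5.1, h5.2, h6.1, h6.2]

theorem momPrim_third_zero :
    |momPrim 0 (5 / 4) - 13.142290663| ≤ 1 / 10 ^ 8 ∧
    |momPrim 1 (5 / 4) - 3.704377957| ≤ 1 / 10 ^ 8 ∧
    |momPrim 2 (5 / 4) - 2.506788505| ≤ 1 / 10 ^ 8 := by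
  have h1 : |Si (2 * π * ((5 / 4) + 1 / 4)) - 1.6747617990| ≤ 3 / 10 ^ 10 := by
    refine Si_two_pi_approx (r := 9.4247779608) ?_ ?_ ?_ ?_ ?_ ?_ <;>
      norm_num [abs_le, SiPoly, Finset.sum_range_succ, Nat.factorial]
  have h2 : |Si (2 * π * ((5 / 4) - 1 / 4)) - 1.4181515761| ≤ 3 / 10 ^ 10 := by
    refine Si_two_pi_approx (r := 6.2831853072) ?_ ?_ ?_ ?_ ?_ ?_ <;>
      norm_num [abs_le, SiPoly, Finset.sum_range_succ, Nat.factorial]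
  have h3 : |Si (2 * π * ((5 / 4) + 3 / 4)) - 1.4921612256| ≤ 3 / 10 ^ 10 := by
    refine Si_two_pi_approx (r := 12.5663706144) ?_ ?_ ?_ ?_ ?_ ?_ <;>
      norm_num [abs_le, SiPoly, Finset.sum_range_succ, Nat.factorial]
  have h4 : |Si (2 * π * ((5 / 4) - 3 / 4)) - 1.8519370520| ≤ 3 / 10 ^ 10 := by
    refine Si_two_pi_approx (r := 3.1415926536) ?_ ?_ ?_ ?_ ?_ ?_ <;>
      norm_num [abs_le, SiPoly, Finset.sum_range_succ, Nat.factorial]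
  have h5 : |Si (2 * π * ((5 / 4) + 5 / 4)) - 1.6339648461| ≤ 3 / 10 ^ 10 := by
    refine Si_two_pi_approx (r := 15.7079632679) ?_ ?_ ?_ ?_ ?_ ?_ <;>
      norm_num [abs_le, SiPoly, Finset.sum_range_succ, Nat.factorial]
  have h6 : |Si (2 * π * ((5 / 4) - 5 / 4)) - 0E-10| ≤ 3 / 10 ^ 10 := by
    refine Si_two_pi_approx (r := 0E-10) ?_ ?_ ?_ ?_ ?_ ?_ <;>
      norm_num [abs_le, SiPoly, Finset.sum_range_succ, Nat.factorial]
  rw [abs_le] at h1 h2 h3 h4 h5 h6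
  simp only [momPrim, kernPrim_one, kernPrim_three, kernPrim_five, abs_le]
  refine ⟨⟨?_, ?_⟩, ⟨?_, ?_⟩, ⟨?_, ?_⟩⟩ <;>
    linarith [h1.1, h1.2, h2.1, h2.2, h3.1, h3.2, h4.1, h4.2, h5.1, h5.2, h6.1, h6.2]

theorem Si_pi_approx : |Si π - 1.8519370520| ≤ 3 / 10 ^ 10 := by
  have h : |Si (2 * π * (1 / 2)) - 1.8519370520| ≤ 3 / 10 ^ 10 := by
    refine Si_two_pi_approx (r := 3.1415926536) ?_ ?_ ?_ ?_ ?_ ?_ <;>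
      norm_num [abs_le, SiPoly, Finset.sum_range_succ, Nat.factorial]
  rwa [show 2 * π * (1 / 2) = π by ring] at h

/-! ### The critical point -/

theorem momPrim_zero_mono {a b : ℝ} (ha : 0 ≤ a) (hab : a ≤ b) (hb : b < 7 / 4) :
    momPrim 0 a ≤ momPrim 0 b := by
  rw [← sub_nonneg, ← integral_momKern]
  exact intervalIntegral.integral_nonneg hab fun z hz =>
    momKern_zero_nonneg (ha.trans hz.1) (hz.2.trans_lt hb)

theorem momPrim_one_mono {a b : ℝ} (ha : 0 ≤ a) (hab : a ≤ b) (hb : b < 7 / 4) :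
    momPrim 1 a ≤ momPrim 1 b := by
  rw [← sub_nonneg, ← integral_momKern]
  refine intervalIntegral.integral_nonneg hab fun z hz => ?_
  rw [momKern_one]
  exact mul_nonneg (sq_nonneg z) (momKern_zero_nonneg (ha.trans hz.1) (hz.2.trans_lt hb))

/-- The second moment kernel is z² times the first, which is nonnegative here. This and its
companion let increments of the second primitive be read off from those of the first. -/
theorem momPrim_two_sub_le {a b : ℝ} (ha : 0 ≤ a) (hab : a ≤ b) (hb : b < 7 / 4) :
    momPrim 2 b - momPrim 2 a ≤ b ^ 2 * (momPrim 1 b - momPrim 1 a) := by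
  rw [← integral_momKern, ← integral_momKern, ← intervalIntegral.integral_const_mul]
  refine intervalIntegral.integral_mono_on hab ((continuous_momKern 2).intervalIntegrable _ _)
    (((continuous_momKern 1).const_mul _).intervalIntegrable _ _) fun z hz => ?_
  rw [momKern_one, momKern_two, ← mul_assoc]
  refine mul_le_mul_of_nonneg_right ?_
    (momKern_zero_nonneg (ha.trans hz.1) (hz.2.trans_lt hb))
  have : z ^ 2 ≤ b ^ 2 := pow_le_pow_left₀ (ha.trans hz.1) hz.2 2
  nlinarith [sq_nonneg z]

theorem le_momPrim_two_sub {a b : ℝ} (ha : 0 ≤ a) (hab : a ≤ b) (hb : b < 7 / 4) :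
    a ^ 2 * (momPrim 1 b - momPrim 1 a) ≤ momPrim 2 b - momPrim 2 a := by
  rw [← integral_momKern, ← integral_momKern, ← intervalIntegral.integral_const_mul]
  refine intervalIntegral.integral_mono_on hab
    (((continuous_momKern 1).const_mul _).intervalIntegrable _ _)
    ((continuous_momKern 2).intervalIntegrable _ _) fun z hz => ?_
  rw [momKern_one, momKern_two, ← mul_assoc]
  refine mul_le_mul_of_nonneg_right ?_
    (momKern_zero_nonneg (ha.trans hz.1) (hz.2.trans_lt hb))
  have : a ^ 2 ≤ z ^ 2 := pow_le_pow_left₀ ha hz.1 2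
  nlinarith [sq_nonneg z]

theorem continuous_momFun (i : ℕ) : Continuous fun p : ℝ × ℝ => momFun i p.1 p.2 := by
  have h := continuous_momPrim i
  unfold momFun
  fun_prop

/-- A common zero of `momFun 1` and `momFun 2` from the signs at three corners of a rectangle. -/
theorem exists_momFun_eq_zero {a₁ b₁ a₂ b₂ : ℝ} (h1 : 0 ≤ a₁) (hab1 : a₁ ≤ b₁) (hb1 : b₁ < 7 / 4)
    (h2 : 0 ≤ a₂) (hab2 : a₂ ≤ b₂) (hb2 : b₂ < 7 / 4)
    (hlow : 0 ≤ momFun 1 a₁ a₂) (hupp : momFun 1 b₁ b₂ ≤ 0)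
    (hleft : 0 ≤ momFun 2 a₁ b₂ - a₂ ^ 2 * momFun 1 a₁ b₂)
    (hright : momFun 2 b₁ b₂ - b₂ ^ 2 * momFun 1 b₁ b₂ ≤ 0) :
    ∃ z₁ ∈ Icc a₁ b₁, ∃ z₂ ∈ Icc a₂ b₂, momFun 1 z₁ z₂ = 0 ∧ momFun 2 z₁ z₂ = 0 := by
  -- `momFun 1` increases in its first variable and decreases in its second, so two opposite corners
  -- give a root z₂ for every z₁.
  have hsolve : ∀ z₁ ∈ Icc a₁ b₁, ∃ z₂ ∈ Icc a₂ b₂, momFun 1 z₁ z₂ = 0 := by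
    intro z₁ hz₁
    have hc : ContinuousOn (fun z₂ => momFun 1 z₁ z₂) (Icc a₂ b₂) :=
      ((continuous_momFun 1).comp (Continuous.prodMk_right z₁)).continuousOn
    refine intermediate_value_Icc' hab2 hc ⟨?_, ?_⟩
    · have := momPrim_one_mono (h1.trans hz₁.1) hz₁.2 hb1
      unfold momFun at *
      linarith
    · have := momPrim_one_mono h1 hz₁.1 (hz₁.2.trans_lt hb1)
      unfold momFun at *
      linarith
  let B := Icc a₁ b₁ ×ˢ Icc a₂ b₂
  have hB : IsCompact B := isCompact_Icc.prod isCompact_Icc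
  have hF1 : IsClosed {p : ℝ × ℝ | momFun 1 p.1 p.2 = 0} :=
    isClosed_eq (continuous_momFun 1) continuous_const
  -- Closed sets of abscissae for which some root of `momFun 1` has `momFun 2` of a given sign. They
  -- cover the interval, so connectedness yields a common point, with no continuous choice of root.
  let T := Prod.fst '' (B ∩ ({p | momFun 1 p.1 p.2 = 0} ∩ {p | 0 ≤ momFun 2 p.1 p.2}))
  let T' := Prod.fst '' (B ∩ ({p | momFun 1 p.1 p.2 = 0} ∩ {p | momFun 2 p.1 p.2 ≤ 0}))
  have hT : IsClosed T := ((hB.inter_right (hF1.inter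
    (isClosed_le continuous_const (continuous_momFun 2)))).image continuous_fst).isClosed
  have hT' : IsClosed T' := ((hB.inter_right (hF1.inter
    (isClosed_le (continuous_momFun 2) continuous_const))).image continuous_fst).isClosed
  have hcov : Icc a₁ b₁ ⊆ T ∪ T' := by
    intro z₁ hz₁
    obtain ⟨z₂, hz₂, h⟩ := hsolve z₁ hz₁
    rcases le_total 0 (momFun 2 z₁ z₂) with h' | h'
    · exact Or.inl ⟨(z₁, z₂), ⟨⟨hz₁, hz₂⟩, h, h'⟩, rfl⟩
    · exact Or.inr ⟨(z₁, z₂), ⟨⟨hz₁, hz₂⟩, h, h'⟩, rfl⟩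
  have hne : (Icc a₁ b₁ ∩ T).Nonempty := by
    have ha : a₁ ∈ Icc a₁ b₁ := left_mem_Icc.2 hab1
    obtain ⟨z₂, hz₂, h⟩ := hsolve a₁ ha
    refine ⟨a₁, ha, (a₁, z₂), ⟨⟨ha, hz₂⟩, h, ?_⟩, rfl⟩
    -- The root z₂ is unknown, so `momFun 2` is transported to the corner (a₁, b₂): its increment is
    -- at least a₂² times that of `momFun 1`, which vanishes at z₂.
    have g1 := le_momPrim_two_sub (h2.trans hz₂.1) hz₂.2 hb2
    have g2 := momPrim_one_mono (h2.trans hz₂.1) hz₂.2 hb2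
    have g3 : a₂ ^ 2 ≤ z₂ ^ 2 := pow_le_pow_left₀ h2 hz₂.1 2
    have g4 := mul_le_mul_of_nonneg_right g3 (sub_nonneg.2 g2)
    have g5 : a₂ ^ 2 * momFun 1 a₁ z₂ = 0 := by rw [h, mul_zero]
    simp only [mem_ofPred_eq]
    unfold momFun at *
    linarith
  have hne' : (Icc a₁ b₁ ∩ T').Nonempty := by
    have hb : b₁ ∈ Icc a₁ b₁ := right_mem_Icc.2 hab1
    obtain ⟨z₂, hz₂, h⟩ := hsolve b₁ hb
    refine ⟨b₁, hb, (b₁, z₂), ⟨⟨hb, hz₂⟩, h, ?_⟩, rfl⟩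
    have g1 := momPrim_two_sub_le (h2.trans hz₂.1) hz₂.2 hb2
    have g5 : b₂ ^ 2 * momFun 1 b₁ z₂ = 0 := by rw [h, mul_zero]
    simp only [mem_ofPred_eq]
    unfold momFun at *
    linarith
  obtain ⟨z₁, hz₁, ⟨p, ⟨hpB, hp1, hp2⟩, rfl⟩, ⟨p', ⟨hpB', hp1', hp2'⟩, hpp⟩⟩ :=
    isPreconnected_closed_iff.1 isPreconnected_Icc T T' hT hT' hcov hne hne'
  refine ⟨p.1, hz₁, p.2, hpB.2, hp1, ?_⟩
  simp only [mem_ofPred_eq] at hp1 hp2 hp1' hp2'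
  rw [hpp] at hp1' hp2'
  refine le_antisymm ?_ hp2
  -- Two roots over the same abscissa share the first primitive, hence by the two-sided comparison
  -- the second, so both signs hold at `p`.
  have e1 : momPrim 1 p.2 = momPrim 1 p'.2 := by
    unfold momFun at hp1 hp1'; linarith
  have e2 : momPrim 2 p.2 = momPrim 2 p'.2 := by
    rcases le_total p.2 p'.2 with hle | hle
    · have g1 := momPrim_two_sub_le (h2.trans hpB.2.1) hle (hpB'.2.2.trans_lt hb2)
      have g2 := le_momPrim_two_sub (h2.trans hpB.2.1) hle (hpB'.2.2.trans_lt hb2)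
      rw [e1, sub_self, mul_zero] at g1 g2
      linarith
    · have g1 := momPrim_two_sub_le (h2.trans hpB'.2.1) hle (hpB.2.2.trans_lt hb2)
      have g2 := le_momPrim_two_sub (h2.trans hpB'.2.1) hle (hpB.2.2.trans_lt hb2)
      rw [e1, sub_self, mul_zero] at g1 g2
      linarith
  unfold momFun at hp2' ⊢
  linarith

theorem exists_critical_point :
    ∃ z₁ ∈ Ico (0.72096 : ℝ) 0.72097, ∃ z₂ ∈ Ico (1.23305 : ℝ) 1.23306,
      momFun 1 z₁ z₂ = 0 ∧ momFun 2 z₁ z₂ = 0 ∧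
      1.08176 * momFun 0 z₁ z₂ ≤ 1024 / 225 ∧ 1024 / 225 < 1.08177 * momFun 0 z₁ z₂ := by
  obtain ⟨p0, p1, p2⟩ := momPrim_left_lower
  obtain ⟨r0, r1, r2⟩ := momPrim_left_upper
  obtain ⟨s0, s1, s2⟩ := momPrim_right_lower
  obtain ⟨t0, t1, t2⟩ := momPrim_right_upper
  obtain ⟨u0, u1, u2⟩ := momPrim_first_zero
  obtain ⟨v0, v1, v2⟩ := momPrim_second_zero
  obtain ⟨w0, w1, w2⟩ := momPrim_third_zero
  rw [abs_le] at p0 p1 p2 r0 r1 r2 s0 s1 s2 t0 t1 t2 u0 u1 u2 v0 v1 v2 w0 w1 w2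
  obtain ⟨z₁, hz₁, z₂, hz₂, h1, h2⟩ := exists_momFun_eq_zero
    (a₁ := 0.7209645) (b₁ := 0.7209649) (a₂ := 1.233059) (b₂ := 1.2330599)
    (by norm_num) (by norm_num) (by norm_num) (by norm_num) (by norm_num) (by norm_num)
    (by unfold momFun; linarith [u1.1, w1.1, v1.2, s1.2, p1.1])
    (by unfold momFun; linarith [u1.2, w1.2, v1.1, t1.1, r1.2])
    (by unfold momFun; norm_num only
        linarith [u1.1, w1.1, v1.2, t1.2, p1.1, u1.2, w1.2, v1.1, t1.1, p1.2,
          u2.1, w2.1, v2.2, t2.2, p2.1])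
    (by unfold momFun; norm_num only
        linarith [u1.1, w1.1, v1.2, t1.2, r1.1, u1.2, w1.2, v1.1, t1.1, r1.2,
          u2.2, w2.2, v2.1, t2.1, r2.2])
  -- Monotonicity encloses `momFun 0` at the unknown zero between values at corners of the
  -- rectangle.
  have m1 := momPrim_zero_mono (by norm_num) hz₁.1 (by linarith [hz₁.2])
  have m2 := momPrim_zero_mono (by linarith [hz₁.1]) hz₁.2 (by norm_num)
  have m3 := momPrim_zero_mono (by norm_num) hz₂.1 (by linarith [hz₂.2])
  have m4 := momPrim_zero_mono (by linarith [hz₂.1]) hz₂.2 (by norm_num)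
  refine ⟨z₁, ⟨by linarith [hz₁.1], by linarith [hz₁.2]⟩, z₂,
    ⟨by linarith [hz₂.1], by linarith [hz₂.2]⟩, h1, h2, ?_, ?_⟩
  · unfold momFun
    linarith [u0.2, w0.2, v0.1, s0.1, r0.2]
  · unfold momFun
    linarith [u0.1, w0.1, v0.2, t0.2, p0.1]

/-! ### The Fourier transform of `φ` -/

theorem fourier_ofReal_of_even {g : ℝ → ℝ} (hg : Integrable g) (heven : ∀ x, g (-x) = g x)
    (z : ℝ) : 𝓕 (fun x : ℝ => (g x : ℂ)) z = ((∫ x, cos (2 * π * z * x) * g x : ℝ) : ℂ) := by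
  simp_rw [Real.fourier_real_eq_integral_exp_smul, smul_eq_mul]
  set G : ℝ → ℂ := fun v => Complex.exp (((-2 * π * v * z : ℝ) : ℂ) * Complex.I) * (g v : ℂ) with hG
  have hgc : Integrable fun x => (g x : ℂ) := hg.ofReal
  have hGi : Integrable G := by
    refine hgc.norm.mono' ?_ ?_
    · refine AEStronglyMeasurable.mul ?_ hgc.aestronglyMeasurable
      exact Continuous.aestronglyMeasurable (by fun_prop)
    · refine Filter.Eventually.of_forall fun v => ?_
      rw [hG, norm_mul, Complex.norm_exp_ofReal_mul_I, one_mul]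
  have h1 : ∫ v, G v = ∫ v, G (-v) := (integral_neg_eq_self G volume).symm
  have h2 : ∫ v, (G v + G (-v)) = ∫ v, ((2 * (cos (2 * π * z * v) * g v) : ℝ) : ℂ) := by
    refine integral_congr_ae (Filter.Eventually.of_forall fun v => ?_)
    simp only [hG, heven]
    rw [← add_mul, show -2 * π * -v * z = -(-2 * π * v * z) by ring,
      show 2 * π * z * v = -(-2 * π * v * z) by ring, cos_neg]
    push_cast
    rw [neg_mul, ← mul_assoc, Complex.cos]
    ring
  rw [integral_add hGi hGi.comp_neg, ← h1, integral_complex_ofReal, integral_const_mul] at h2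
  push_cast at h2 ⊢
  linear_combination h2 / 2

theorem sigma_eq (k : ℤ) (x : ℝ) :
    sigma k x = π / q k * sin (2 * π * (q k * max 0 (1 - |x|))) := by
  unfold sigma
  split_ifs with h
  · rw [max_eq_right (by linarith)]
  · rw [max_eq_left (by linarith)]; simp

theorem continuous_sigma (k : ℤ) : Continuous (sigma k) := by
  have : sigma k = fun x => π / q k * sin (2 * π * (q k * max 0 (1 - |x|))) :=
    funext (sigma_eq k)
  rw [this]
  fun_prop

theorem sigma_neg (k : ℤ) (x : ℝ) : sigma k (-x) = sigma k x := by simp [sigma]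

theorem sigma_eq_zero (k : ℤ) {x : ℝ} (hx : 1 ≤ |x|) : sigma k x = 0 := if_neg hx.not_gt

theorem integrable_of_eq_zero {g : ℝ → ℝ} (hg : Continuous g) (h0 : ∀ x, 1 ≤ |x| → g x = 0) :
    Integrable g := by
  refine hg.integrable_of_hasCompactSupport
    (HasCompactSupport.intro (isCompact_Icc (a := (-1 : ℝ)) (b := 1)) fun x hx => h0 x ?_)
  by_contra h
  exact hx (abs_le.1 (not_le.1 h).le)

theorem integral_cos_mul_eq_sinc (a : ℝ) : ∫ x in (0 : ℝ)..1, cos (a * x) = sinc a := by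
  rcases eq_or_ne a 0 with rfl | ha
  · simp
  · rw [intervalIntegral.integral_comp_mul_left (fun x => cos x) ha, integral_cos,
      sinc_of_ne_zero ha]
    simp [div_eq_inv_mul]

/-- As cos(2πq_k) = 0, on [0, 1] σ_k is a multiple of cos(2πq_k x); product-to-sum turns the cosine
transform into two `sinc` values. -/
theorem fourier_sigma {k : ℤ} (hc : cos (2 * π * q k) = 0) (z : ℝ) :
    𝓕 (fun x : ℝ => (sigma k x : ℂ)) z = (kern (q k) z : ℂ) := by
  rw [fourier_ofReal_of_even (integrable_of_eq_zero (continuous_sigma k)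
    fun x => sigma_eq_zero k) (sigma_neg k)]
  congr 1
  have h1 : ∫ x, cos (2 * π * z * x) * sigma k x = ∫ x, cos (2 * π * z * |x|) * sigma k |x| := by
    refine integral_congr_ae (Filter.Eventually.of_forall fun x => ?_)
    rcases abs_choice x with h | h <;> simp only [h, sigma_neg, mul_neg, cos_neg]
  rw [h1, integral_comp_abs (f := fun x => cos (2 * π * z * x) * sigma k x),
    setIntegral_eq_of_subset_of_forall_sdiff_eq_zero (s := Ioc 0 1) measurableSet_Ioi
      Ioc_subset_Ioi_self, ← intervalIntegral.integral_of_le zero_le_one]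
  · have h2 : ∀ x ∈ uIcc (0 : ℝ) 1, cos (2 * π * z * x) * sigma k x =
        sin (2 * π * q k) * (π / q k) / 2 *
          (cos (2 * π * (z + q k) * x) + cos (2 * π * (z - q k) * x)) := by
      intro x hx
      rw [uIcc_of_le zero_le_one] at hx
      rw [sigma_eq, abs_of_nonneg hx.1, max_eq_right (by linarith [hx.2]),
        show 2 * π * (q k * (1 - x)) = 2 * π * q k - 2 * π * q k * x by ring, sin_sub, hc,
        show 2 * π * (z + q k) * x = 2 * π * z * x + 2 * π * q k * x by ring,
        show 2 * π * (z - q k) * x = 2 * π * z * x - 2 * π * q k * x by ring, cos_add, cos_sub]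
      ring
    rw [intervalIntegral.integral_congr h2, intervalIntegral.integral_const_mul,
      intervalIntegral.integral_add (Continuous.intervalIntegrable (by fun_prop) _ _)
        (Continuous.intervalIntegrable (by fun_prop) _ _),
      integral_cos_mul_eq_sinc, integral_cos_mul_eq_sinc, kern]
    ring
  · intro x hx
    rw [sigma_eq_zero, mul_zero]
    rw [mem_sdiff, mem_Ioc, not_and, not_le] at hx
    rw [abs_of_pos hx.1]
    exact (hx.2 hx.1).le

theorem q_one : q 1 = 1 / 4 := by norm_num [q]

theorem q_two : q 2 = 3 / 4 := by norm_num [q]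

theorem q_three : q 3 = 5 / 4 := by norm_num [q]

theorem omega_one (w₁ w₂ : ℝ) :
    omega w₁ w₂ 1 (q 1) = 4 / 3 * ((w₁ ^ 2 - 1 / 16) * (w₂ ^ 2 - 1 / 16)) := by
  rw [omega, show (Finset.Icc (1 : ℤ) 3).erase 1 = {2, 3} by decide,
    Finset.prod_pair (by decide), q_one, q_two, q_three]
  ring

theorem omega_two (w₁ w₂ : ℝ) :
    omega w₁ w₂ 2 (q 2) = -2 * ((w₁ ^ 2 - 9 / 16) * (w₂ ^ 2 - 9 / 16)) := by
  rw [omega, show (Finset.Icc (1 : ℤ) 3).erase 2 = {1, 3} by decide,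
    Finset.prod_pair (by decide), q_one, q_two, q_three]
  ring

theorem omega_three (w₁ w₂ : ℝ) :
    omega w₁ w₂ 3 (q 3) = 2 / 3 * ((w₁ ^ 2 - 25 / 16) * (w₂ ^ 2 - 25 / 16)) := by
  rw [omega, show (Finset.Icc (1 : ℤ) 3).erase 3 = {1, 2} by decide,
    Finset.prod_pair (by decide), q_one, q_two, q_three]
  ring

theorem phi_eq (w₁ w₂ x : ℝ) : phi w₁ w₂ x =
    omega w₁ w₂ 1 (q 1) * sigma 1 x + omega w₁ w₂ 2 (q 2) * sigma 2 x +
      omega w₁ w₂ 3 (q 3) * sigma 3 x := by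
  rw [phi, show Finset.Icc (1 : ℤ) 3 = {1, 2, 3} by decide, Finset.sum_insert (by decide),
    Finset.sum_pair (by decide)]
  ring

theorem continuous_phi (w₁ w₂ : ℝ) : Continuous (phi w₁ w₂) := by
  have h := continuous_sigma
  rw [funext (phi_eq w₁ w₂)]
  fun_prop

theorem phi_eq_zero (w₁ w₂ : ℝ) {x : ℝ} (hx : 1 ≤ |x|) : phi w₁ w₂ x = 0 := by
  simp [phi_eq, sigma_eq_zero _ hx]

/-- The Fourier transform of `φ` as a combination of the kernels `momKern`. -/
theorem fourier_phi (w₁ w₂ z : ℝ) : 𝓕 (fun x : ℝ => (phi w₁ w₂ x : ℂ)) z =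
    ((w₁ ^ 2 * w₂ ^ 2 * momKern 0 z - (w₁ ^ 2 + w₂ ^ 2) * momKern 1 z + momKern 2 z : ℝ) : ℂ) := by
  have hi : ∀ k, Integrable fun x : ℝ => cos (2 * π * z * x) * sigma k x := fun k => by
    refine integrable_of_eq_zero ?_ fun x hx => by rw [sigma_eq_zero k hx, mul_zero]
    have := continuous_sigma k
    fun_prop
  have hs : ∀ k, cos (2 * π * q k) = 0 →
      ∫ x, cos (2 * π * z * x) * sigma k x = kern (q k) z := fun k hk => by
    have h := fourier_sigma hk z
    rw [fourier_ofReal_of_even (integrable_of_eq_zero (continuous_sigma k)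
      fun x => sigma_eq_zero k) (sigma_neg k)] at h
    exact_mod_cast h
  rw [fourier_ofReal_of_even (integrable_of_eq_zero (continuous_phi w₁ w₂)
    fun x => phi_eq_zero w₁ w₂) (phi_neg w₁ w₂)]
  congr 1
  have h : ∀ x, cos (2 * π * z * x) * phi w₁ w₂ x =
      omega w₁ w₂ 1 (q 1) * (cos (2 * π * z * x) * sigma 1 x) +
      omega w₁ w₂ 2 (q 2) * (cos (2 * π * z * x) * sigma 2 x) +
      omega w₁ w₂ 3 (q 3) * (cos (2 * π * z * x) * sigma 3 x) := fun x => by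
    rw [phi_eq]; ring
  have h12 : Integrable fun x => omega w₁ w₂ 1 (q 1) * (cos (2 * π * z * x) * sigma 1 x) +
      omega w₁ w₂ 2 (q 2) * (cos (2 * π * z * x) * sigma 2 x) :=
    ((hi 1).const_mul _).add ((hi 2).const_mul _)
  simp_rw [h]
  rw [integral_add h12 ((hi 3).const_mul _), integral_add ((hi 1).const_mul _) ((hi 2).const_mul _), integral_const_mul,
    integral_const_mul, integral_const_mul, hs 1 (by rw [q_one, cos_half_pi_one]),
    hs 2 (by rw [q_two, cos_half_pi_three]), hs 3 (by rw [q_three, cos_half_pi_five]),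
    omega_one, omega_two, omega_three, q_one, q_two, q_three, momKern, momKern, momKern]
  ring

theorem phiHat_eq (w₁ w₂ z : ℝ) : phiHat w₁ w₂ z =
    w₁ ^ 2 * w₂ ^ 2 * momKern 0 z - (w₁ ^ 2 + w₂ ^ 2) * momKern 1 z + momKern 2 z := by
  rw [phiHat, fourier_phi, Complex.ofReal_re]

theorem fourier_phi_eq_phiHat (w₁ w₂ z : ℝ) :
    𝓕 (fun x : ℝ => (phi w₁ w₂ x : ℂ)) z = (phiHat w₁ w₂ z : ℂ) := by
  rw [fourier_phi, phiHat_eq]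

theorem continuous_phiHat (w₁ w₂ : ℝ) : Continuous (phiHat w₁ w₂) := by
  have h := continuous_momKern
  rw [funext (phiHat_eq w₁ w₂)]
  fun_prop

theorem phiHat_neg (w₁ w₂ z : ℝ) : phiHat w₁ w₂ (-z) = phiHat w₁ w₂ z := by
  simp [phiHat_eq, momKern_neg]

theorem phiHat_eq_mul (w₁ w₂ z : ℝ) :
    phiHat w₁ w₂ z = (w₁ ^ 2 - z ^ 2) * (w₂ ^ 2 - z ^ 2) * momKern 0 z := by
  rw [phiHat_eq, momKern_one, momKern_two]
  ring

theorem exists_abs_momKern_le (i : ℕ) : ∃ C, 0 ≤ C ∧ ∀ z, |momKern i z| ≤ C * (1 + z ^ 2)⁻¹ := by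
  refine ⟨(4 / 3 * (1 / 16) ^ i + 2 * (9 / 16) ^ i + 2 / 3 * (25 / 16) ^ i) * 160, by positivity,
    fun z => ?_⟩
  have h1 := abs_kern_le (q := 1 / 4) (by norm_num) (by norm_num) (by norm_num) cos_half_pi_one z
  have h3 := abs_kern_le (q := 3 / 4) (by norm_num) (by norm_num) (by norm_num) cos_half_pi_three z
  have h5 := abs_kern_le (q := 5 / 4) (by norm_num) (by norm_num) (by norm_num) cos_half_pi_five z
  have c1 : (0 : ℝ) ≤ 4 / 3 * (1 / 16) ^ i := by positivity
  have c3 : (0 : ℝ) ≤ 2 * (9 / 16) ^ i := by positivity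
  have c5 : (0 : ℝ) ≤ 2 / 3 * (25 / 16) ^ i := by positivity
  unfold momKern
  calc _ ≤ |4 / 3 * (1 / 16) ^ i * kern (1 / 4) z| + |2 * (9 / 16) ^ i * kern (3 / 4) z| +
        |2 / 3 * (25 / 16) ^ i * kern (5 / 4) z| :=
        (abs_add_le _ _).trans (add_le_add_left (abs_sub _ _) _)
    _ ≤ 4 / 3 * (1 / 16) ^ i * (160 * (1 + z ^ 2)⁻¹) + 2 * (9 / 16) ^ i * (160 * (1 + z ^ 2)⁻¹) +
        2 / 3 * (25 / 16) ^ i * (160 * (1 + z ^ 2)⁻¹) := by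
        rw [abs_mul _ (kern _ z), abs_mul _ (kern _ z), abs_mul _ (kern _ z), abs_of_nonneg c1, abs_of_nonneg c3, abs_of_nonneg c5]
        gcongr
    _ = _ := by ring

theorem exists_abs_phiHat_le (w₁ w₂ : ℝ) :
    ∃ C, 0 ≤ C ∧ ∀ z, |phiHat w₁ w₂ z| ≤ C * (1 + z ^ 2)⁻¹ := by
  obtain ⟨C0, hC0, h0⟩ := exists_abs_momKern_le 0
  obtain ⟨C1, hC1, h1⟩ := exists_abs_momKern_le 1
  obtain ⟨C2, hC2, h2⟩ := exists_abs_momKern_le 2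
  refine ⟨w₁ ^ 2 * w₂ ^ 2 * C0 + (w₁ ^ 2 + w₂ ^ 2) * C1 + C2, by positivity, fun z => ?_⟩
  rw [phiHat_eq]
  calc _ ≤ |w₁ ^ 2 * w₂ ^ 2 * momKern 0 z| + |(w₁ ^ 2 + w₂ ^ 2) * momKern 1 z| + |momKern 2 z| :=
        (abs_add_le _ _).trans (add_le_add_left (abs_sub _ _) _)
    _ ≤ w₁ ^ 2 * w₂ ^ 2 * (C0 * (1 + z ^ 2)⁻¹) + (w₁ ^ 2 + w₂ ^ 2) * (C1 * (1 + z ^ 2)⁻¹) +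
        C2 * (1 + z ^ 2)⁻¹ := by
        rw [abs_mul _ (momKern _ z), abs_mul _ (momKern _ z),
          abs_of_nonneg (by positivity : 0 ≤ w₁ ^ 2 * w₂ ^ 2),
          abs_of_nonneg (by positivity : 0 ≤ w₁ ^ 2 + w₂ ^ 2)]
        gcongr
        exacts [h0 z, h1 z, h2 z]
    _ = _ := by ring

theorem integrable_phiHat (w₁ w₂ : ℝ) : Integrable (phiHat w₁ w₂) := by
  obtain ⟨C, -, hC⟩ := exists_abs_phiHat_le w₁ w₂
  exact (integrable_inv_one_add_sq.const_mul C).mono'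
    (continuous_phiHat w₁ w₂).aestronglyMeasurable (Filter.Eventually.of_forall hC)

/-! ### Poisson summation for `F_n` -/

theorem continuous_e : Continuous e := by
  unfold e
  fun_prop

theorem e_add (s t : ℝ) : e (s + t) = e s * e t := by
  simp only [e, ← Complex.exp_add]
  push_cast
  ring_nf

theorem e_intCast (m : ℤ) : e m = 1 := by
  rw [e, show (2 * π * Complex.I * ((m : ℝ) : ℂ) : ℂ) = m * (2 * π * Complex.I) by push_cast; ring,
    Complex.exp_int_mul_two_pi_mul_I]

theorem norm_e (t : ℝ) : ‖e t‖ = 1 := by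
  rw [e, show (2 * π * Complex.I * (t : ℂ) : ℂ) = ((2 * π * t : ℝ) : ℂ) * Complex.I by
    push_cast; ring, Complex.norm_exp_ofReal_mul_I]

theorem summable_inv_one_add_int_sq : Summable fun m : ℤ => (1 + (m : ℝ) ^ 2)⁻¹ := by
  refine (Real.summable_one_div_int_pow.2 one_lt_two).of_norm_bounded_eventually ?_
  refine (finite_singleton (0 : ℤ)).subset fun m hm => ?_
  by_contra h0
  refine hm ?_
  have h1 : (m : ℝ) ≠ 0 := by exact_mod_cast h0
  rw [mem_ofPred_eq, norm_of_nonneg (by positivity), one_div]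
  gcongr
  linarith

theorem summable_phiHat_scaled (w₁ w₂ : ℝ) {n : ℕ} (hn : 1 ≤ n) (x : ℝ) :
    Summable fun m : ℤ => (n : ℝ) * phiHat w₁ w₂ (n * (x + m)) := by
  obtain ⟨C, hC0, hC⟩ := exists_abs_phiHat_le w₁ w₂
  refine Summable.mul_left _ (Summable.of_norm_bounded
    ((summable_inv_one_add_int_sq.mul_left (2 + 2 * x ^ 2)).mul_left C) fun m => ?_)
  refine (hC _).trans (mul_le_mul_of_nonneg_left ?_ hC0)
  rw [← div_eq_mul_inv, inv_eq_one_div, div_le_div_iff₀ (by positivity) (by positivity)]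
  have hn' : (1 : ℝ) ≤ n := by exact_mod_cast hn
  have h1 : (x + m) ^ 2 ≤ ((n : ℝ) * (x + m)) ^ 2 := by
    rw [mul_pow]
    exact le_mul_of_one_le_left (sq_nonneg _) (one_le_pow₀ hn')
  nlinarith [sq_nonneg (2 * x + (m : ℝ)), sq_nonneg (x * (x + m)), sq_nonneg x]

/-- Poisson summation for y ↦ φ(y/n) e(-xy), whose transform at m is n φ̂(n(x + m)). -/
theorem F_eq_tsum (w₁ w₂ : ℝ) {n : ℕ} (hn : 1 ≤ n) (x : ℝ) :
    F w₁ w₂ n x = ∑' m : ℤ, (n : ℝ) * phiHat w₁ w₂ (n * (x + m)) := by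
  have hn0 : (0 : ℝ) < n := by exact_mod_cast hn
  set f : ℝ → ℂ := fun y => (phi w₁ w₂ (y / n) : ℂ) * e (-(x * y)) with hf
  have hfc : Continuous f := by
    have h1 := continuous_phi w₁ w₂
    have h2 := continuous_e
    fun_prop
  have hf0 : ∀ y : ℝ, (n : ℝ) ≤ |y| → f y = 0 := fun y hy => by
    rw [hf]
    simp only
    rw [phi_eq_zero, Complex.ofReal_zero, zero_mul]
    rwa [abs_div, abs_of_pos hn0, le_div_iff₀ hn0, one_mul]
  have hfs : HasCompactSupport f :=
    HasCompactSupport.intro (isCompact_Icc (a := -(n : ℝ)) (b := n)) fun y hy => hf0 y <| by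
      by_contra h
      exact hy (abs_le.1 (not_le.1 h).le)
  have hFf : ∀ m : ℤ, 𝓕 f m = (((n : ℝ) * phiHat w₁ w₂ (n * (x + m)) : ℝ) : ℂ) := fun m => by
    rw [Complex.ofReal_mul, ← fourier_phi_eq_phiHat]
    simp_rw [Real.fourier_real_eq_integral_exp_smul, smul_eq_mul]
    have h := Measure.integral_comp_div (fun v : ℝ =>
      Complex.exp (((-2 * π * v * (n * (x + m)) : ℝ) : ℂ) * Complex.I) * (phi w₁ w₂ v : ℂ)) n
    rw [abs_of_pos hn0, Complex.real_smul] at h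
    rw [← h]
    refine integral_congr_ae (Filter.Eventually.of_forall fun y => ?_)
    simp only [hf, e]
    rw [mul_comm (phi w₁ w₂ (y / n) : ℂ), ← mul_assoc, ← Complex.exp_add]
    congr 2
    have : (n : ℂ) ≠ 0 := by exact_mod_cast hn0.ne'
    push_cast
    field_simp
    ring
  have hsum : Summable fun m : ℤ => 𝓕 f m := by
    simp_rw [hFf]
    exact Complex.summable_ofReal.2 (summable_phiHat_scaled w₁ w₂ hn x)
  have hO : f =O[Filter.cocompact ℝ] fun y : ℝ => |y| ^ (-2 : ℝ) :=
    (Filter.coclosedCompact_eq_cocompact (X := ℝ) ▸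
      hasCompactSupport_iff_eventuallyEq.1 hfs).trans_isBigO (Asymptotics.isBigO_zero _ _)
  have key := Real.tsum_eq_tsum_fourier_of_rpow_decay_of_summable hfc one_lt_two hO hsum 0
  have hr : ∑' m : ℤ, 𝓕 f m * fourier m ((0 : ℝ) : UnitAddCircle) =
      ((∑' m : ℤ, (n : ℝ) * phiHat w₁ w₂ (n * (x + m)) : ℝ) : ℂ) := by
    rw [Complex.ofReal_tsum]
    refine tsum_congr fun m => ?_
    rw [hFf]
    simp
  -- The samples carry e(-νx), so they sum to the conjugate of the real number F_n(x); those with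
  -- |ν| ≥ n vanish with φ.
  have hl : ∑' m : ℤ, f (0 + m) = (F w₁ w₂ n x : ℂ) := by
    rw [tsum_eq_sum (s := Finset.Ioo (-(n : ℤ)) n), ← Complex.conj_ofReal, coe_F, map_sum]
    · refine Finset.sum_congr rfl fun ν _ => ?_
      rw [map_mul, Complex.conj_ofReal, conj_e, zero_add, mul_comm (ν : ℝ) x]
    · intro ν hν
      rw [zero_add]
      refine hf0 _ ?_
      rw [Finset.mem_Ioo, ← abs_lt, not_lt] at hν
      exact_mod_cast hν
  rw [hr, hl] at key
  exact_mod_cast key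

theorem F_periodic (w₁ w₂ : ℝ) (n : ℕ) : Function.Periodic (F w₁ w₂ n) 1 := fun x => by
  unfold F
  congr 1
  refine Finset.sum_congr rfl fun ν _ => ?_
  rw [mul_add, mul_one, e_add, e_intCast, mul_one]

theorem continuous_F (w₁ w₂ : ℝ) (n : ℕ) : Continuous (F w₁ w₂ n) := by
  have := continuous_e
  unfold F
  fun_prop

theorem isRealTrigPoly_F (w₁ w₂ : ℝ) (n : ℕ) : IsRealTrigPoly n (F w₁ w₂ n) :=
  ⟨fun ν => phi w₁ w₂ (ν / n), coe_F w₁ w₂ n⟩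

/-- Unfolding of the integral of `F_n` against a bounded periodic function. -/
theorem integral_F_mul (w₁ w₂ : ℝ) {n : ℕ} (hn : 1 ≤ n) {s : ℝ → ℝ} (hs : Measurable s)
    (hs1 : ∀ x, |s x| ≤ 1) (hper : Function.Periodic s 1) :
    ∫ x in (0 : ℝ)..1, F w₁ w₂ n x * s x = ∫ y, (n : ℝ) * phiHat w₁ w₂ (n * y) * s y := by
  have hn0 : (n : ℝ) ≠ 0 := by exact_mod_cast (by omega : n ≠ 0)
  have hfi : Integrable fun y => (n : ℝ) * phiHat w₁ w₂ (n * y) * s y :=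
    (((integrable_phiHat w₁ w₂).comp_mul_left' hn0).const_mul (n : ℝ)).mul_bdd
      hs.aestronglyMeasurable (Filter.Eventually.of_forall hs1)
  have h1 := hfi.hasSum_intervalIntegral_comp_add_int
  have h2 := hfi.norm.hasSum_intervalIntegral_comp_add_int
  -- Integrability on the line makes the norms of the translated pieces summable, which licenses
  -- exchanging sum and integral.
  simp_rw [intervalIntegral.integral_of_le zero_le_one] at h1 h2 ⊢
  have h3 := hasSum_integral_of_summable_integral_norm (μ := volume.restrict (Ioc (0 : ℝ) 1))
    (F := fun (m : ℤ) x => (n : ℝ) * phiHat w₁ w₂ (n * (x + m)) * s (x + m))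
    (fun m => (hfi.comp_add_right (m : ℝ)).restrict) h2.summable
  rw [← h3.unique h1]
  refine integral_congr_ae (Filter.Eventually.of_forall fun x => ?_)
  simp only
  rw [F_eq_tsum w₁ w₂ hn, ← tsum_mul_right]
  refine tsum_congr fun m => ?_
  have : s (x + m) = s x := by simpa using hper.int_mul m x
  rw [this]

theorem normL_eq_of_periodic {t : ℝ → ℝ} (ht : Function.Periodic t 1) :
    normL t = ∫ x in (0 : ℝ)..1, |t x| := by
  have hp : Function.Periodic (fun x => |t x|) 1 := fun x => by simp only [ht x]
  have := hp.intervalIntegral_add_eq (-(1 / 2)) 0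
  rw [normL]
  norm_num at this ⊢
  exact this

/-- Unfold the integral of F_n against its own sign, then rescale by n. -/
theorem normL_F_le (w₁ w₂ : ℝ) {n : ℕ} (hn : 1 ≤ n) :
    normL (F w₁ w₂ n) ≤ ∫ z, |phiHat w₁ w₂ z| := by
  have hn0 : (0 : ℝ) < n := by exact_mod_cast hn
  set s : ℝ → ℝ := fun x => if 0 ≤ F w₁ w₂ n x then 1 else -1 with hs
  have hsm : Measurable s := Measurable.ite
    (measurableSet_le measurable_const (continuous_F w₁ w₂ n).measurable)
    measurable_const measurable_const
  have hs1 : ∀ x, |s x| ≤ 1 := fun x => by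
    simp only [hs]; split_ifs <;> simp
  have hsp : Function.Periodic s 1 := fun x => by simp only [hs, F_periodic w₁ w₂ n x]
  have habs : ∀ x, |F w₁ w₂ n x| = F w₁ w₂ n x * s x := fun x => by
    simp only [hs]
    split_ifs with h
    · rw [abs_of_nonneg h, mul_one]
    · rw [abs_of_neg (not_le.1 h), mul_neg_one]
  rw [normL_eq_of_periodic (F_periodic w₁ w₂ n)]
  simp_rw [habs]
  rw [integral_F_mul w₁ w₂ hn hsm hs1 hsp]
  have h1 : ∫ y, (n : ℝ) * |phiHat w₁ w₂ (n * y)| = ∫ z, |phiHat w₁ w₂ z| := by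
    rw [integral_const_mul, Measure.integral_comp_mul_left (fun z => |phiHat w₁ w₂ z|),
      smul_eq_mul, abs_of_pos (inv_pos.2 hn0), mul_inv_cancel_left₀ hn0.ne']
  rw [← h1]
  have hi : Integrable fun y => (n : ℝ) * phiHat w₁ w₂ (n * y) :=
    ((integrable_phiHat w₁ w₂).comp_mul_left' hn0.ne').const_mul (n : ℝ)
  refine integral_mono (hi.mul_bdd hsm.aestronglyMeasurable (Filter.Eventually.of_forall hs1))
    (((integrable_phiHat w₁ w₂).abs.comp_mul_left' hn0.ne').const_mul (n : ℝ)) fun y => ?_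
  refine (le_abs_self _).trans ?_
  rw [abs_mul, abs_mul, abs_of_pos hn0]
  exact mul_le_of_le_one_right (by positivity) (hs1 y)

/-- In the Poisson series at 0, the term m ≠ 0 is at most n C/(nm)² = (C/n)/m² in absolute value. -/
theorem exists_F_zero_ge (w₁ w₂ : ℝ) : ∃ K : ℝ, 0 ≤ K ∧ ∀ n : ℕ, 1 ≤ n →
    n * phiHat w₁ w₂ 0 - K / n ≤ F w₁ w₂ n 0 := by
  obtain ⟨C, hC0, hC⟩ := exists_abs_phiHat_le w₁ w₂
  have hsum : Summable fun m : ℤ => 1 / (m : ℝ) ^ 2 := Real.summable_one_div_int_pow.2 one_lt_two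
  refine ⟨C * ∑' m : ℤ, 1 / (m : ℝ) ^ 2,
    mul_nonneg hC0 (tsum_nonneg fun m => by positivity), fun n hn => ?_⟩
  have hn0 : (0 : ℝ) < n := by exact_mod_cast hn
  have hs := summable_phiHat_scaled w₁ w₂ hn 0
  rw [F_eq_tsum w₁ w₂ hn, hs.tsum_eq_add_tsum_ite 0]
  have hb : ‖∑' m : ℤ, if m = 0 then 0 else (n : ℝ) * phiHat w₁ w₂ (n * (0 + m))‖ ≤
      C / n * ∑' m : ℤ, 1 / (m : ℝ) ^ 2 := by
    refine tsum_of_norm_bounded (hsum.hasSum.mul_left (C / n)) fun m => ?_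
    split_ifs with hm
    · rw [norm_zero]; positivity
    · have hm' : (m : ℝ) ≠ 0 := by exact_mod_cast hm
      have hp : 0 < ((n : ℝ) * m) ^ 2 := by positivity
      rw [zero_add, norm_mul, norm_of_nonneg hn0.le]
      calc (n : ℝ) * ‖phiHat w₁ w₂ (n * m)‖ ≤ n * (C * (1 + ((n : ℝ) * m) ^ 2)⁻¹) := by
            gcongr; exact hC _
        _ ≤ n * (C * (((n : ℝ) * m) ^ 2)⁻¹) := by
            gcongr; linarith
        _ = C / n * (1 / (m : ℝ) ^ 2) := by field_simp
  rw [norm_eq_abs] at hb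
  have h1 := (abs_le.1 hb).1
  have h2 : C * (∑' m : ℤ, 1 / (m : ℝ) ^ 2) / n = C / n * ∑' m : ℤ, 1 / (m : ℝ) ^ 2 := by ring
  simp only [Int.cast_zero, add_zero, mul_zero] at h1 ⊢
  rw [h2]
  linarith

/-! ### The `L¹` norm of `φ̂` -/

theorem F_one (w₁ w₂ x : ℝ) : F w₁ w₂ 1 x = phi w₁ w₂ 0 := by
  rw [F, show Finset.Ioo (-((1 : ℕ) : ℤ)) ((1 : ℕ) : ℤ) = {0} by decide]
  simp [e]

/-- The sign of `cos (2πz)`. -/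
noncomputable def cosSign (z : ℝ) : ℝ := Real.sign (cos (2 * π * z))

theorem measurable_cosSign : Measurable cosSign := by
  have hc : Measurable fun z : ℝ => cos (2 * π * z) := (by fun_prop : Continuous _).measurable
  unfold cosSign Real.sign
  exact Measurable.ite (measurableSet_lt hc measurable_const) measurable_const
    (Measurable.ite (measurableSet_lt measurable_const hc) measurable_const measurable_const)

theorem abs_cosSign_le (z : ℝ) : |cosSign z| ≤ 1 := by
  unfold cosSign
  rcases Real.sign_apply_eq (cos (2 * π * z)) with h | h | h <;> rw [h] <;> simp

theorem cosSign_neg (z : ℝ) : cosSign (-z) = cosSign z := by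
  rw [cosSign, mul_neg, cos_neg, cosSign]

theorem cosSign_add_half (z : ℝ) : cosSign (z + 1 / 2) = -cosSign z := by
  rw [cosSign, show 2 * π * (z + 1 / 2) = 2 * π * z + π by ring, cos_add_pi, Real.sign_neg, cosSign]

theorem cosSign_periodic : Function.Periodic cosSign 1 := fun z => by
  rw [show z + 1 = z + 1 / 2 + 1 / 2 by ring, cosSign_add_half, cosSign_add_half, neg_neg]

theorem intervalIntegrable_cosSign (a b : ℝ) : IntervalIntegrable cosSign volume a b :=
  (intervalIntegrable_const (c := (1 : ℝ))).mono_fun measurable_cosSign.aestronglyMeasurable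
    (Filter.Eventually.of_forall fun z => by simpa using abs_cosSign_le z)

theorem integral_cosSign : ∫ z in (0 : ℝ)..1, cosSign z = 0 := by
  have h := intervalIntegral.integral_comp_add_right (a := 0) (b := 1 / 2) cosSign (1 / 2)
  simp_rw [cosSign_add_half, intervalIntegral.integral_neg] at h
  rw [← intervalIntegral.integral_add_adjacent_intervals (intervalIntegrable_cosSign 0 (1 / 2))
    (intervalIntegrable_cosSign (1 / 2) 1)]
  norm_num at h ⊢
  linarith

/-- Unfolding with n = 1: F_1 is the constant φ(0), and the sign of cos(2πz) has mean zero over a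
period. -/
theorem integral_phiHat_mul_cosSign (w₁ w₂ : ℝ) : ∫ z, phiHat w₁ w₂ z * cosSign z = 0 := by
  have h := integral_F_mul w₁ w₂ le_rfl measurable_cosSign abs_cosSign_le cosSign_periodic
  simp_rw [F_one, intervalIntegral.integral_const_mul, integral_cosSign] at h
  simpa using h.symm

theorem phiHat_nonpos {w₁ w₂ z : ℝ} (hw₁ : 0 < w₁) (hz₁ : w₁ ≤ z) (hz₂ : z ≤ w₂)
    (hz : z < 7 / 4) : phiHat w₁ w₂ z ≤ 0 := by
  rw [phiHat_eq_mul]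
  refine mul_nonpos_of_nonpos_of_nonneg (mul_nonpos_of_nonpos_of_nonneg ?_ ?_)
    (momKern_zero_nonneg (hw₁.le.trans hz₁) hz) <;> nlinarith

theorem phiHat_nonneg {w₁ w₂ z : ℝ} (hw₁ : 0 < w₁) (hw : w₁ < w₂) (hz0 : 0 ≤ z)
    (h : z ≤ w₁ ∨ w₂ ≤ z) (hz : z < 7 / 4) : 0 ≤ phiHat w₁ w₂ z := by
  rw [phiHat_eq_mul]
  refine mul_nonneg ?_ (momKern_zero_nonneg hz0 hz)
  rcases h with h | h
  · exact mul_nonneg (by nlinarith) (by nlinarith)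
  · exact mul_nonneg_of_nonpos_of_nonpos (by nlinarith) (by nlinarith)

theorem phiHat_mul_cosSign_of_ge {w₁ w₂ z : ℝ} (hw₁ : w₁ ∈ Ioo (1 / 2 : ℝ) 1)
    (hw₂ : w₂ ∈ Ioo (1 : ℝ) (3 / 2)) (hz : 7 / 4 ≤ z) :
    phiHat w₁ w₂ z * cosSign z = -|phiHat w₁ w₂ z| := by
  have hp : 0 < (w₁ ^ 2 - z ^ 2) * (w₂ ^ 2 - z ^ 2) :=
    mul_pos_of_neg_of_neg (by nlinarith [hw₁.1, hw₁.2]) (by nlinarith [hw₂.1, hw₂.2])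
  have hprod : (1 / 16 - z ^ 2) * (9 / 16 - z ^ 2) * (25 / 16 - z ^ 2) < 0 :=
    mul_neg_of_pos_of_neg (mul_pos_of_neg_of_neg (by nlinarith) (by nlinarith)) (by nlinarith)
  have h := momKern_zero_mul z
  rw [phiHat_eq_mul, cosSign, ← h, abs_mul, abs_of_pos hp]
  rcases lt_trichotomy (momKern 0 z) 0 with hg | hg | hg
  · rw [Real.sign_of_pos (mul_pos_of_neg_of_neg hprod hg), abs_of_neg hg]; ring
  · rw [hg]; simp
  · rw [Real.sign_of_neg (mul_neg_of_neg_of_pos hprod hg), abs_of_pos hg]; ring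

/-- Below 7/4, |φ̂| = φ̂(1 - 2·1_{(w₁, w₂]}) and the sign of the cosine is 2·1_{cos > 0} - 1 off its
zeros; from 7/4 on the two terms cancel. -/
theorem abs_phiHat_add_of_pos {w₁ w₂ z : ℝ} (hw₁ : w₁ ∈ Ioo (1 / 2 : ℝ) 1)
    (hw₂ : w₂ ∈ Ioo (1 : ℝ) (3 / 2)) (hz0 : 0 < z) (hz1 : z ≠ 1 / 4) (hz3 : z ≠ 3 / 4)
    (hz5 : z ≠ 5 / 4) :
    |phiHat w₁ w₂ z| + phiHat w₁ w₂ z * cosSign z =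
      2 * ((Ioc 0 (1 / 4)).indicator (phiHat w₁ w₂) z +
        (Ioc (3 / 4) (5 / 4)).indicator (phiHat w₁ w₂) z -
        (Ioc w₁ w₂).indicator (phiHat w₁ w₂) z) := by
  have hw1 := hw₁.1
  have hw1' := hw₁.2
  have hw2 := hw₂.1
  have hw2' := hw₂.2
  simp only [indicator_apply, mem_Ioc]
  rcases le_or_gt (7 / 4) z with hz | hz
  · rw [phiHat_mul_cosSign_of_ge hw₁ hw₂ hz, if_neg (by intro h; linarith [h.2]),
      if_neg (by intro h; linarith [h.2]), if_neg (by intro h; linarith [h.2])]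
    ring
  have hA : |phiHat w₁ w₂ z| = phiHat w₁ w₂ z -
      2 * if w₁ < z ∧ z ≤ w₂ then phiHat w₁ w₂ z else 0 := by
    split_ifs with h
    · rw [abs_of_nonpos (phiHat_nonpos (by linarith) h.1.le h.2 hz)]; ring
    · rw [abs_of_nonneg (phiHat_nonneg (by linarith) (by linarith) hz0.le ?_ hz)]
      · ring
      · by_contra! h'
        exact h ⟨h'.1, h'.2.le⟩
  have hS : cosSign z = 2 * ((if 0 < z ∧ z ≤ 1 / 4 then 1 else 0) +
      if 3 / 4 < z ∧ z ≤ 5 / 4 then 1 else 0) - 1 := by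
    unfold cosSign
    rcases lt_or_gt_of_ne hz1 with h1 | h1
    · rw [Real.sign_of_pos (cos_two_pi_pos_of_lt hz0.le h1), if_pos ⟨hz0, h1.le⟩,
        if_neg (by intro h; linarith [h.1])]
      norm_num
    rw [if_neg (by intro h; linarith [h.2])]
    rcases lt_or_gt_of_ne hz3 with h3 | h3
    · rw [Real.sign_of_neg (cos_two_pi_neg_of_mem h1 h3), if_neg (by intro h; linarith [h.1])]
      norm_num
    rcases lt_or_gt_of_ne hz5 with h5 | h5
    · rw [Real.sign_of_pos (cos_two_pi_pos_of_mem h3 h5), if_pos ⟨h3, h5.le⟩]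
      norm_num
    · rw [Real.sign_of_neg (cos_two_pi_neg_of_mem' h5 hz), if_neg (by intro h; linarith [h.2])]
      norm_num
  rw [hA, hS]
  split_ifs <;> ring

/-- The denominator of `ρ`. -/
noncomputable def rhoDen (w₁ w₂ : ℝ) : ℝ :=
  4 * ((∫ z in (0 : ℝ)..q 1, phiHat w₁ w₂ z) + (∫ z in q 2..q 3, phiHat w₁ w₂ z) -
    ∫ z in w₁..w₂, phiHat w₁ w₂ z)

theorem rho_eq (w₁ w₂ : ℝ) : rho w₁ w₂ = phiHat w₁ w₂ 0 / rhoDen w₁ w₂ := rfl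

/-- Of the factor 4, one 2 comes from evenness and the other from the pointwise identity on the
half-line. -/
theorem integral_abs_phiHat {w₁ w₂ : ℝ} (hw₁ : w₁ ∈ Ioo (1 / 2 : ℝ) 1)
    (hw₂ : w₂ ∈ Ioo (1 : ℝ) (3 / 2)) : ∫ z, |phiHat w₁ w₂ z| = rhoDen w₁ w₂ := by
  have hi := integrable_phiHat w₁ w₂
  have hS : Integrable fun z => phiHat w₁ w₂ z * cosSign z :=
    hi.mul_bdd measurable_cosSign.aestronglyMeasurable
      (Filter.Eventually.of_forall abs_cosSign_le)
  have h1 : ∫ z, |phiHat w₁ w₂ z| = ∫ z, (|phiHat w₁ w₂ z| + phiHat w₁ w₂ z * cosSign z) := by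
    rw [integral_add hi.abs hS, integral_phiHat_mul_cosSign, add_zero]
  have h2 : ∀ z, |phiHat w₁ w₂ z| + phiHat w₁ w₂ z * cosSign z =
      |phiHat w₁ w₂ (|z|)| + phiHat w₁ w₂ (|z|) * cosSign (|z|) := fun z => by
    rcases abs_choice z with h | h <;> rw [h]
    rw [phiHat_neg, cosSign_neg]
  have h3 : ∫ z in Ioi (0 : ℝ), (|phiHat w₁ w₂ z| + phiHat w₁ w₂ z * cosSign z) =
      ∫ z, 2 * ((Ioc 0 (1 / 4)).indicator (phiHat w₁ w₂) z +
        (Ioc (3 / 4) (5 / 4)).indicator (phiHat w₁ w₂) z -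
        (Ioc w₁ w₂).indicator (phiHat w₁ w₂) z) := by
    rw [← integral_indicator measurableSet_Ioi]
    refine integral_congr_ae ?_
    have hfin : ∀ᵐ z : ℝ, z ∉ ({1 / 4, 3 / 4, 5 / 4} : Set ℝ) :=
      measure_eq_zero_iff_ae_notMem.1 (Set.Finite.measure_zero (by simp) volume)
    filter_upwards [hfin] with z hz
    simp only [mem_insert_iff, mem_singleton_iff, not_or] at hz
    by_cases h0 : 0 < z
    · rw [indicator_of_mem (mem_Ioi.2 h0), abs_phiHat_add_of_pos hw₁ hw₂ h0 hz.1 hz.2.1 hz.2.2]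
    · rw [indicator_of_notMem (by simpa using h0), indicator_of_notMem, indicator_of_notMem,
        indicator_of_notMem]
      · ring
      all_goals
        rintro ⟨h, -⟩
        exact h0 (by linarith [hw₁.1])
  have i1 : Integrable ((Ioc (0 : ℝ) (1 / 4)).indicator (phiHat w₁ w₂)) :=
    hi.indicator measurableSet_Ioc
  have i2 : Integrable ((Ioc (3 / 4 : ℝ) (5 / 4)).indicator (phiHat w₁ w₂)) :=
    hi.indicator measurableSet_Ioc
  have i3 : Integrable ((Ioc w₁ w₂).indicator (phiHat w₁ w₂)) := hi.indicator measurableSet_Ioc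
  have i12 : Integrable fun z => (Ioc (0 : ℝ) (1 / 4)).indicator (phiHat w₁ w₂) z +
      (Ioc (3 / 4 : ℝ) (5 / 4)).indicator (phiHat w₁ w₂) z := i1.add i2
  rw [h1, integral_congr_ae (Filter.Eventually.of_forall h2), integral_comp_abs (f := fun z => |phiHat w₁ w₂ z| + phiHat w₁ w₂ z * cosSign z), h3,
    integral_const_mul, integral_sub i12 i3, integral_add i1 i2, integral_indicator
    measurableSet_Ioc, integral_indicator measurableSet_Ioc, integral_indicator measurableSet_Ioc,
    rhoDen, q_one, q_two, q_three, intervalIntegral.integral_of_le (by norm_num),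
    intervalIntegral.integral_of_le (by norm_num),
    intervalIntegral.integral_of_le (by linarith [hw₁.2, hw₂.1])]
  ring

/-! ### Real trigonometric polynomials -/

theorem integral_e_intCast_mul (m : ℤ) :
    ∫ x in (-(1 / 2) : ℝ)..(1 / 2), e (m * x) = if m = 0 then 1 else 0 := by
  split_ifs with hm
  · subst hm; norm_num [e]
  · have hc : (2 * π * Complex.I * m : ℂ) ≠ 0 := by
      simp [hm, Real.pi_ne_zero]
    have h : ∀ x : ℝ, e (m * x) = Complex.exp (2 * π * Complex.I * m * x) := fun x => by
      rw [e]; push_cast; ring_nf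
    simp_rw [h]
    rw [integral_exp_mul_complex hc, div_eq_zero_iff, sub_eq_zero]
    left
    rw [Complex.exp_eq_exp_iff_exists_int]
    exact ⟨m, by push_cast; ring⟩

theorem IsRealTrigPoly.continuous {n : ℕ} {t : ℝ → ℝ} (ht : IsRealTrigPoly n t) :
    Continuous t := by
  obtain ⟨a, ha⟩ := ht
  have h : t = fun x => (∑ ν ∈ Finset.Ioo (-(n : ℤ)) (n : ℤ), a ν * e (ν * x)).re :=
    funext fun x => by rw [← ha, Complex.ofReal_re]
  have := continuous_e
  rw [h]
  fun_prop

theorem abs_le_normC {t : ℝ → ℝ} (ht : Continuous t) {x : ℝ}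
    (hx : x ∈ Icc (-(1 / 2) : ℝ) (1 / 2)) : |t x| ≤ normC t :=
  le_csSup (isCompact_Icc.image ht.abs).bddAbove (mem_image_of_mem _ hx)

theorem normC_nonneg (t : ℝ → ℝ) : 0 ≤ normC t := by
  refine Real.sSup_nonneg ?_
  rintro _ ⟨x, -, rfl⟩
  exact abs_nonneg _

theorem normL_nonneg (t : ℝ → ℝ) : 0 ≤ normL t :=
  intervalIntegral.integral_nonneg (by norm_num) fun x _ => abs_nonneg _

/-- Every Fourier coefficient is bounded by the L norm. The crude constant makes the set defining
`bestConst` bounded above, so that its `sSup` is a genuine supremum. -/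
theorem IsRealTrigPoly.normC_le {n : ℕ} {t : ℝ → ℝ} (ht : IsRealTrigPoly n t) :
    normC t ≤ (Finset.Ioo (-(n : ℤ)) (n : ℤ)).card * normL t := by
  have htc := ht.continuous
  obtain ⟨a, ha⟩ := ht
  have he := continuous_e
  have hcoef : ∀ μ ∈ Finset.Ioo (-(n : ℤ)) (n : ℤ), ‖a μ‖ ≤ normL t := by
    intro μ hμ
    have h1 : ∫ x in (-(1 / 2) : ℝ)..(1 / 2), (t x : ℂ) * e (-(μ * x)) = a μ := by
      have h2 : ∀ x : ℝ, (t x : ℂ) * e (-(μ * x)) =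
          ∑ ν ∈ Finset.Ioo (-(n : ℤ)) (n : ℤ), a ν * e (((ν - μ : ℤ) : ℝ) * x) := fun x => by
        rw [ha, Finset.sum_mul]
        refine Finset.sum_congr rfl fun ν _ => ?_
        rw [mul_assoc, ← e_add]
        push_cast
        ring_nf
      simp_rw [h2]
      rw [intervalIntegral.integral_finsetSum fun ν _ =>
        Continuous.intervalIntegrable (by fun_prop) _ _]
      simp_rw [intervalIntegral.integral_const_mul, integral_e_intCast_mul, sub_eq_zero]
      simp [Finset.mem_Ioo.1 hμ]
    rw [← h1]
    refine (intervalIntegral.norm_integral_le_integral_norm (by norm_num)).trans (le_of_eq ?_)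
    refine intervalIntegral.integral_congr fun x _ => ?_
    rw [norm_mul, norm_e, mul_one, Complex.norm_real, norm_eq_abs]
  refine Real.sSup_le ?_ (mul_nonneg (Nat.cast_nonneg _) (normL_nonneg t))
  rintro _ ⟨x, -, rfl⟩
  have h3 : |t x| = ‖(t x : ℂ)‖ := by rw [Complex.norm_real, norm_eq_abs]
  simp only
  rw [h3, ha, ← nsmul_eq_mul]
  refine norm_sum_le_of_le _ (fun ν hν => ?_) |>.trans (Finset.sum_le_card_nsmul _ _ _ hcoef)
  rw [norm_mul, norm_e, mul_one]

theorem le_bestConst {n : ℕ} {t : ℝ → ℝ} (ht : IsRealTrigPoly n t) :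
    normC t / normL t ≤ bestConst n := by
  by_cases h0 : t = 0
  · have : normL t = 0 := by simp [h0, normL]
    rw [this, div_zero]
    refine Real.sSup_nonneg ?_
    rintro _ ⟨u, -, -, rfl⟩
    exact div_nonneg (normC_nonneg u) (normL_nonneg u)
  · refine le_csSup ⟨(Finset.Ioo (-(n : ℤ)) (n : ℤ)).card, ?_⟩ ⟨t, ht, h0, rfl⟩
    rintro _ ⟨u, hu, -, rfl⟩
    exact div_le_of_le_mul₀ (normL_nonneg u) (Nat.cast_nonneg _) hu.normC_le

/-! ### The lower bound for the polynomials `F_n` -/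

theorem exists_rho_mul_sub_le {w₁ w₂ : ℝ} (hw₁ : w₁ ∈ Ioo (1 / 2 : ℝ) 1)
    (hw₂ : w₂ ∈ Ioo (1 : ℝ) (3 / 2)) (hden : 0 < rhoDen w₁ w₂) :
    ∃ K : ℝ, ∀ n : ℕ, 1 ≤ n →
      rho w₁ w₂ * n - K / n ≤ normC (F w₁ w₂ n) / normL (F w₁ w₂ n) := by
  obtain ⟨K, -, hK⟩ := exists_F_zero_ge w₁ w₂
  refine ⟨K / rhoDen w₁ w₂, fun n hn => ?_⟩
  have h1 := hK n hn
  have h2 : F w₁ w₂ n 0 ≤ normC (F w₁ w₂ n) :=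
    (le_abs_self _).trans (abs_le_normC (continuous_F w₁ w₂ n) ⟨by norm_num, by norm_num⟩)
  have h3 : normL (F w₁ w₂ n) ≤ rhoDen w₁ w₂ :=
    (normL_F_le w₁ w₂ hn).trans_eq (integral_abs_phiHat hw₁ hw₂)
  have h4 : rho w₁ w₂ * n - K / rhoDen w₁ w₂ / n =
      (n * phiHat w₁ w₂ 0 - K / n) / rhoDen w₁ w₂ := by
    rw [rho_eq]; ring
  rw [h4]
  refine (div_le_div_of_nonneg_right (h1.trans h2) hden.le).trans ?_
  -- If the L norm vanishes then so does the C norm, and both quotients are 0.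
  rcases (normL_nonneg (F w₁ w₂ n)).eq_or_lt with h0 | h0
  · have h5 := (isRealTrigPoly_F w₁ w₂ n).normC_le
    rw [← h0, mul_zero] at h5
    rw [← h0, div_zero, le_antisymm h5 (normC_nonneg _), zero_div]
  · exact div_le_div_of_nonneg_left (normC_nonneg _) h0 h3

/-! ### The maximum of `ρ` -/

theorem integral_phiHat (w₁ w₂ a b : ℝ) : ∫ z in a..b, phiHat w₁ w₂ z =
    w₁ ^ 2 * w₂ ^ 2 * (momPrim 0 b - momPrim 0 a) - (w₁ ^ 2 + w₂ ^ 2) * (momPrim 1 b - momPrim 1 a) +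
      (momPrim 2 b - momPrim 2 a) := by
  rw [intervalIntegral.integral_eq_sub_of_hasDerivAt (fun z _ => by
    have h := (((hasDerivAt_momPrim 0 z).const_mul (w₁ ^ 2 * w₂ ^ 2)).sub
      ((hasDerivAt_momPrim 1 z).const_mul (w₁ ^ 2 + w₂ ^ 2))).add (hasDerivAt_momPrim 2 z)
    rwa [← phiHat_eq] at h) ((continuous_phiHat w₁ w₂).intervalIntegrable _ _)]
  simp only [Pi.add_apply, Pi.sub_apply]
  ring

theorem integrals_phiHat (w₁ w₂ z₁ z₂ : ℝ) :
    (∫ z in (0 : ℝ)..q 1, phiHat w₁ w₂ z) + (∫ z in q 2..q 3, phiHat w₁ w₂ z) -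
      ∫ z in z₁..z₂, phiHat w₁ w₂ z =
    w₁ ^ 2 * w₂ ^ 2 * momFun 0 z₁ z₂ - (w₁ ^ 2 + w₂ ^ 2) * momFun 1 z₁ z₂ + momFun 2 z₁ z₂ := by
  simp only [integral_phiHat, momPrim_zero, q_one, q_two, q_three, momFun]
  ring

theorem phiHat_zero (w₁ w₂ : ℝ) : phiHat w₁ w₂ 0 = 4096 / 225 * (w₁ ^ 2 * w₂ ^ 2) := by
  have h := momKern_zero_mul 0
  rw [mul_zero, cos_zero] at h
  rw [phiHat_eq_mul]
  linear_combination 4096 / 225 * (w₁ ^ 2 * w₂ ^ 2) * h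

/-- φ̂ is nonpositive between w₁ and w₂ and nonnegative elsewhere on [0, 7/4), so moving either
endpoint in any direction adds a nonnegative amount. -/
theorem integral_phiHat_le {w₁ w₂ z₁ z₂ : ℝ} (hw₁ : w₁ ∈ Ioo (1 / 2 : ℝ) 1)
    (hw₂ : w₂ ∈ Ioo (1 : ℝ) (3 / 2)) (hz₁ : z₁ ∈ Ioo (1 / 2 : ℝ) 1)
    (hz₂ : z₂ ∈ Ioo (1 : ℝ) (3 / 2)) :
    ∫ z in w₁..w₂, phiHat w₁ w₂ z ≤ ∫ z in z₁..z₂, phiHat w₁ w₂ z := by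
  obtain ⟨a1, a2⟩ := hw₁
  obtain ⟨b1, b2⟩ := hw₂
  obtain ⟨c1, c2⟩ := hz₁
  obtain ⟨d1, d2⟩ := hz₂
  have hii : ∀ a b : ℝ, IntervalIntegrable (phiHat w₁ w₂) volume a b := fun a b =>
    (continuous_phiHat w₁ w₂).intervalIntegrable a b
  have h1 : 0 ≤ ∫ z in z₁..w₁, phiHat w₁ w₂ z := by
    rcases le_total z₁ w₁ with h | h
    · exact intervalIntegral.integral_nonneg h fun z hz => phiHat_nonneg (by linarith)
        (by linarith) (by linarith [hz.1]) (Or.inl hz.2) (by linarith [hz.2])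
    · rw [intervalIntegral.integral_symm, ← intervalIntegral.integral_neg]
      exact intervalIntegral.integral_nonneg h fun z hz => neg_nonneg.2 <|
        phiHat_nonpos (by linarith) hz.1 (by linarith [hz.2]) (by linarith [hz.2])
  have h2 : 0 ≤ ∫ z in w₂..z₂, phiHat w₁ w₂ z := by
    rcases le_total w₂ z₂ with h | h
    · exact intervalIntegral.integral_nonneg h fun z hz => phiHat_nonneg (by linarith)
        (by linarith) (by linarith [hz.1]) (Or.inr hz.1) (by linarith [hz.2])
    · rw [intervalIntegral.integral_symm, ← intervalIntegral.integral_neg]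
      exact intervalIntegral.integral_nonneg h fun z hz => neg_nonneg.2 <|
        phiHat_nonpos (by linarith) (by linarith [hz.1]) hz.2 (by linarith [hz.2])
  have h3 := intervalIntegral.integral_add_adjacent_intervals (hii z₁ w₁) (hii w₁ w₂)
  have h4 := intervalIntegral.integral_add_adjacent_intervals (hii z₁ w₂) (hii w₂ z₂)
  linarith

/-- Exchanging (w₁, w₂) for (z₁, z₂) as limits of integration lowers the denominator to a
combination of moments, of which only the zeroth survives. -/
theorem le_rhoDen {w₁ w₂ z₁ z₂ : ℝ} (hw₁ : w₁ ∈ Ioo (1 / 2 : ℝ) 1)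
    (hw₂ : w₂ ∈ Ioo (1 : ℝ) (3 / 2)) (hz₁ : z₁ ∈ Ioo (1 / 2 : ℝ) 1)
    (hz₂ : z₂ ∈ Ioo (1 : ℝ) (3 / 2)) (h1 : momFun 1 z₁ z₂ = 0) (h2 : momFun 2 z₁ z₂ = 0) :
    4 * (w₁ ^ 2 * w₂ ^ 2) * momFun 0 z₁ z₂ ≤ rhoDen w₁ w₂ := by
  have h := integrals_phiHat w₁ w₂ z₁ z₂
  rw [h1, h2] at h
  have h3 := integral_phiHat_le hw₁ hw₂ hz₁ hz₂
  rw [rhoDen]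
  linarith

theorem rhoDen_critical {z₁ z₂ : ℝ} (h1 : momFun 1 z₁ z₂ = 0) (h2 : momFun 2 z₁ z₂ = 0) :
    rhoDen z₁ z₂ = 4 * (z₁ ^ 2 * z₂ ^ 2) * momFun 0 z₁ z₂ := by
  rw [rhoDen, integrals_phiHat, h1, h2]
  ring

theorem rho_critical {z₁ z₂ : ℝ} (hz₁ : z₁ ∈ Ioo (1 / 2 : ℝ) 1) (hz₂ : z₂ ∈ Ioo (1 : ℝ) (3 / 2))
    (h1 : momFun 1 z₁ z₂ = 0) (h2 : momFun 2 z₁ z₂ = 0) :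
    rho z₁ z₂ = 1024 / 225 / momFun 0 z₁ z₂ := by
  have e1 : z₁ ≠ 0 := by linarith [hz₁.1]
  have e2 : z₂ ≠ 0 := by linarith [hz₂.1]
  rw [rho_eq, phiHat_zero, rhoDen_critical h1 h2]
  field_simp
  norm_num

/-- The factor w₁²w₂² cancels between φ̂(0) and the lower bound for the denominator, leaving a bound
independent of w. -/
theorem rho_le_rho_critical {w₁ w₂ z₁ z₂ : ℝ} (hw₁ : w₁ ∈ Ioo (1 / 2 : ℝ) 1)
    (hw₂ : w₂ ∈ Ioo (1 : ℝ) (3 / 2)) (hz₁ : z₁ ∈ Ioo (1 / 2 : ℝ) 1)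
    (hz₂ : z₂ ∈ Ioo (1 : ℝ) (3 / 2)) (h1 : momFun 1 z₁ z₂ = 0) (h2 : momFun 2 z₁ z₂ = 0)
    (h0 : 0 < momFun 0 z₁ z₂) : rho w₁ w₂ ≤ rho z₁ z₂ := by
  have e1 : 0 < w₁ := by linarith [hw₁.1]
  have e2 : 0 < w₂ := by linarith [hw₂.1]
  have hle := le_rhoDen hw₁ hw₂ hz₁ hz₂ h1 h2
  have hpos : 0 < 4 * (w₁ ^ 2 * w₂ ^ 2) * momFun 0 z₁ z₂ := by positivity
  rw [rho_critical hz₁ hz₂ h1 h2, rho_eq, phiHat_zero,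
    div_le_div_iff₀ (hpos.trans_le hle) h0]
  linarith

/-! ### Taykov's constant -/

theorem Si_pi_pos : 0 < Si π := by
  linarith [(abs_le.1 Si_pi_approx).1]

/-- The numerator cancels the factors with j = 2, 3, leaving a single kernel; in the denominator of
ρ the last two integrals then cancel as well. -/
theorem phiHat_q_two_q_three (z : ℝ) : phiHat (q 2) (q 3) z = kern (1 / 4) z := by
  rw [phiHat_eq, q_two, q_three, momKern, momKern, momKern]
  ring

theorem rhoDen_q_two_q_three : rhoDen (q 2) (q 3) = 8 * Si π := by
  rw [rhoDen, add_sub_cancel_right, q_one]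
  simp_rw [phiHat_q_two_q_three]
  rw [intervalIntegral.integral_eq_sub_of_hasDerivAt
    (fun z _ => hasDerivAt_kernPrim (by norm_num) z)
    ((continuous_kern _).intervalIntegrable _ _), kernPrim_zero, kernPrim_one, sub_self, mul_zero,
    Si_zero, show 2 * π * (1 / 4 + 1 / 4) = π by ring]
  ring

theorem rho_q_two_q_three : rho (q 2) (q 3) = 2 / ∫ t in (0 : ℝ)..π, sin t / t := by
  have := Si_pi_pos.ne'
  rw [rho_eq, phiHat_zero, rhoDen_q_two_q_three, integral_sin_div_eq_Si, q_two, q_three]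
  field_simp
  norm_num

theorem two_div_integral_sin_div_mem :
    (2 / ∫ t in (0 : ℝ)..π, sin t / t) ∈ Ico (1.07995 : ℝ) 1.07996 := by
  have h := abs_le.1 Si_pi_approx
  rw [integral_sin_div_eq_Si, mem_Ico, le_div_iff₀ Si_pi_pos, div_lt_iff₀ Si_pi_pos]
  constructor <;> linarith

end TrigNorms

theorem mainTheorem2 :
    (∃ z₁ z₂ : ℝ,
      z₁ ∈ Set.Ioo (1 / 2 : ℝ) 1 ∧ z₂ ∈ Set.Ioo (1 : ℝ) (3 / 2) ∧
      -- `(z₁, z₂)` maximizes `ρ`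
      (∀ w₁ ∈ Set.Ioo (1 / 2 : ℝ) 1, ∀ w₂ ∈ Set.Ioo (1 : ℝ) (3 / 2),
        TrigNorms.rho w₁ w₂ ≤ TrigNorms.rho z₁ z₂) ∧
      -- `z₁ = 0.72096…`, `z₂ = 1.23305…`, `ρ(z₁, z₂) = 1.08176…`
      z₁ ∈ Set.Ico (0.72096 : ℝ) 0.72097 ∧
      z₂ ∈ Set.Ico (1.23305 : ℝ) 1.23306 ∧
      TrigNorms.rho z₁ z₂ ∈ Set.Ico (1.08176 : ℝ) 1.08177 ∧
      -- the polynomials `F_n` with these parameters give the bound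
      (∃ K : ℝ, ∀ n : ℕ, 1 ≤ n →
        TrigNorms.rho z₁ z₂ * n - K / n ≤
          TrigNorms.normC (TrigNorms.F z₁ z₂ n) / TrigNorms.normL (TrigNorms.F z₁ z₂ n)) ∧
      (∃ K : ℝ, ∀ n : ℕ, 1 ≤ n →
        TrigNorms.rho z₁ z₂ * n - K / n ≤ TrigNorms.bestConst n)) ∧
    -- Taykov's constant is the value of `ρ` at `(q_2, q_3)`
    TrigNorms.rho (TrigNorms.q 2) (TrigNorms.q 3) =
      2 / ∫ t in (0 : ℝ)..Real.pi, Real.sin t / t ∧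
    (2 / ∫ t in (0 : ℝ)..Real.pi, Real.sin t / t) ∈ Set.Ico (1.07995 : ℝ) 1.07996 ∧
    (∃ K : ℝ, ∀ n : ℕ, 1 ≤ n →
      (2 / ∫ t in (0 : ℝ)..Real.pi, Real.sin t / t) * n - K / n ≤
        TrigNorms.normC (TrigNorms.F (TrigNorms.q 2) (TrigNorms.q 3) n) /
          TrigNorms.normL (TrigNorms.F (TrigNorms.q 2) (TrigNorms.q 3) n)) := by
  open TrigNorms in
  refine ⟨?_, rho_q_two_q_three, two_div_integral_sin_div_mem, ?_⟩
  · obtain ⟨z₁, hz₁, z₂, hz₂, h1, h2, hlow, hupp⟩ := exists_critical_point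
    have hz₁' : z₁ ∈ Ioo (1 / 2 : ℝ) 1 := ⟨by linarith [hz₁.1], by linarith [hz₁.2]⟩
    have hz₂' : z₂ ∈ Ioo (1 : ℝ) (3 / 2) := ⟨by linarith [hz₂.1], by linarith [hz₂.2]⟩
    have h0 : 0 < momFun 0 z₁ z₂ := by linarith
    have hden : 0 < rhoDen z₁ z₂ := by
      have e1 : 0 < z₁ := by linarith [hz₁.1]
      have e2 : 0 < z₂ := by linarith [hz₂.1]
      rw [rhoDen_critical h1 h2]
      positivity
    obtain ⟨K, hK⟩ := exists_rho_mul_sub_le hz₁' hz₂' hden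
    refine ⟨z₁, z₂, hz₁', hz₂', fun w₁ hw₁ w₂ hw₂ =>
      rho_le_rho_critical hw₁ hw₂ hz₁' hz₂' h1 h2 h0, hz₁, hz₂, ?_, ⟨K, hK⟩,
      K, fun n hn => (hK n hn).trans (le_bestConst (isRealTrigPoly_F z₁ z₂ n))⟩
    rw [rho_critical hz₁' hz₂' h1 h2, mem_Ico, le_div_iff₀ h0, div_lt_iff₀ h0]
    exact ⟨hlow, hupp⟩
  · obtain ⟨K, hK⟩ := exists_rho_mul_sub_le (w₁ := q 2) (w₂ := q 3)
      (by rw [q_two]; constructor <;> norm_num) (by rw [q_three]; constructor <;> norm_num)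
      (by rw [rhoDen_q_two_q_three]; linarith [Si_pi_pos])
    exact ⟨K, fun n hn => by rw [← rho_q_two_q_three]; exact hK n hn⟩
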